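/- **Oracle.** Let $N,T\ge 1$ be integers, $[N]=\{0,\dots,N-1\}$, and let $D$ be a probability distribution on $[N]$ that is represented by a map $O_D:[T]\to[N]$, i.e. $D(i)=|\{t\in[T]:O_D(t)=i\}|/T$ for all $i\in[N]$. For $S\subseteq[N]$ write $D(S)=\sum_{i\in S}D(i)$. A query to the quantum sampling oracle $\mathsf{QSAMP}_D$ applies the unitary $U_D|t\rangle|\beta\rangle=|t\rangle|\beta+O_D(t) \bmod N\rangle$. A quantum algorithm making $M$ queries starts in a fixed computational basis state of a query register $[T]$, an answer register $[N]$ and a finite-dimensional workspace, applies unitaries $V_0,U_D,V_1,U_D,\dots,U_D,V_M$ (with $U_D$ extended by the identity on the workspace), where the $V_k$ do not depend on $O_D$, measures in the computational basis, and outputs a real number that is a fixed function of the measurement result. **Theorem.** There are a universal constant $c>0$ and a family of quantum algorithms $\textsc{AddEstProb}$, specified by $N$, $T$, a set $S\subseteq[N]$, an integer $M\ge 0$ and a confidence parameter $\delta\in(0,1]$, such that for all such $N,T,S,M,\delta$ the following holds. The algorithm makes exactly $M$ queries to $\mathsf{QSAMP}_D$, and for every distribution $D$ on $[N]$ and every map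 $O_D:[T]\to[N]$ representing $D$, its output $\tilde D(S)$ satisfies $$\mathbb{P}\big[\,|\tilde D(S)-D(S)|\le\varepsilon\,\big]\ \ge\ 1-\delta$$ for every $\varepsilon>0$ with $$M\ \ge\ c\,\log(1/\delta)\,\max\!\left(\frac{\sqrt{D(S)}}{\varepsilon},\frac1{\sqrt\varepsilon}\right).$$ -/

import Mathlib

open scoped Matrix

noncomputable section

namespace QSamp

/-- Weight `D(S) = ∑ i ∈ S, D(i)` of a set `S ⊆ [N]`. -/
def weight {N : ℕ} (D : Fin N → ℝ) (S : Finset (Fin N)) : ℝ := ∑ i ∈ S, D i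

/-- `O : [T] → [N]` represents `D`: `D(i) = |{t ∈ [T] : O(t) = i}| / T` for every `i`. -/
def Represents {N T : ℕ} (O : Fin T → Fin N) (D : Fin N → ℝ) : Prop :=
  ∀ i, D i = ((Finset.univ.filter fun t => O t = i).card : ℝ) / (T : ℝ)

/-- Labels of the computational basis `|t⟩|β⟩|w⟩`: the query register `[T]`, the answer register
`[N]`, and a workspace with `d + 1` basis states. -/
abbrev Basis (N T d : ℕ) : Type := Fin T × Fin N × Fin (d + 1)

/-- The quantum sampling oracle, tensored with the identity on the workspace, as a matrix:
`|t⟩|β⟩|w⟩ ↦ |t⟩|β + O(t) mod N⟩|w⟩` (addition in `Fin N` is addition modulo `N`). -/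
def oracle {N T : ℕ} (O : Fin T → Fin N) (d : ℕ) :
    Matrix (Basis N T d) (Basis N T d) ℂ :=
  fun x y => if x = (y.1, y.2.1 + O y.1, y.2.2) then 1 else 0

/-- A quantum query algorithm in the standard circuit form. It starts in `|0⟩|0⟩|0⟩`, applies
`gate 0`, then for `k = 1, …, queries` applies the oracle once followed by the unitary `gate k`,
measures all registers in the computational basis, and outputs the real number `output x` when
the result is `x`. None of the data may refer to the oracle. -/
structure QueryAlgorithm (N T : ℕ) where
  /-- the number of oracle calls -/
  queries : ℕ
  /-- the workspace has `work + 1` basis states -/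
  work : ℕ
  /-- the oracle-independent unitaries (only those with index at most `queries` are applied) -/
  gate : ℕ → Matrix.unitaryGroup (Basis N T work) ℂ
  /-- classical postprocessing of the measurement result -/
  output : Basis N T work → ℝ

namespace QueryAlgorithm

variable {N T : ℕ} [NeZero N] [NeZero T]

/-- The state vector after `k` oracle calls, and the gates `gate 0, …, gate k`. -/
def stateAfter (A : QueryAlgorithm N T) (O : Fin T → Fin N) : ℕ → (Basis N T A.work → ℂ)
  | 0 => (A.gate 0 : Matrix (Basis N T A.work) (Basis N T A.work) ℂ) *ᵥ
      Pi.single ((0, 0, 0) : Basis N T A.work) 1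
  | k + 1 => (A.gate (k + 1) : Matrix (Basis N T A.work) (Basis N T A.work) ℂ) *ᵥ
      (oracle O A.work *ᵥ stateAfter A O k)

/-- The state vector that is measured, after exactly `queries` oracle calls. -/
def finalState (A : QueryAlgorithm N T) (O : Fin T → Fin N) : Basis N T A.work → ℂ :=
  A.stateAfter O A.queries

open Classical in
/-- Probability (Born rule) that the output of `A`, run with the oracle of `O`, lies in `E`. -/
def outputProb (A : QueryAlgorithm N T) (O : Fin T → Fin N) (E : Set ℝ) : ℝ :=
  ∑ x, if A.output x ∈ E then ‖A.finalState O x‖ ^ 2 else 0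

end QueryAlgorithm

end QSamp

end

noncomputable section

namespace QSamp

/-! ### The geometric kernel -/

/-! The algorithm is amplitude estimation with a product window. Put p = D(S) = sin²θ. A Grover
iteration costs two queries and rotates the plane of marked and unmarked samples by 2θ. A counter
register holds w with amplitude proportional to the coefficient of X^w in (1 + X + ⋯ + X^n)^K and
controls w iterations. After a Fourier transform of the counter on L points, outcome y has
probability proportional to |kernel(z)|^(2K), averaged over the two phases ±2θ, with z = exp(±2iθ)
ω^y (`outputProb_eq_sum`, `sum_norm_sq_groverAmp`, `norm_sq_sum_dft_window`). If |z - 1| ≤ u, the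
estimate sin²(πy/L) is off by at most u√p + u²/4 (`abs_sin_sq_sub_le`), which produces the maximum
of √p/ε and 1/√ε. It remains to show that z is close to 1 with probability at least 1 - δ.

Let η = log(1/δ); the window uses about M/2 iterations, so n is about M/(2K). For η ≥ 1/32, K is of
order η: the kernel is at least (n+1)/2 near 1 and at most (n+1)/4 at distance beyond 8/(n+1), so
the K-th power makes the tail exponentially small in K (`concentration_long`). For small η the
hypothesis may only allow an arc of length proportional to η/n, but success probability η suffices
because 1 - δ ≤ η; a single factor K = 1 gives such an arc its proportional share
(`concentration_short`). Both bounds compare sums over a fine grid, evaluated by Parseval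
(`parseval_grid`) and by counting grid points (`le_card_near`). -/

/-- The geometric sum `1 + z + ⋯ + z ^ (n - 1)`. -/
def kern (n : ℕ) (z : ℂ) : ℂ := ∑ j ∈ Finset.range n, z ^ j

lemma norm_pow_sub_one_le {z : ℂ} (hz : ‖z‖ = 1) (j : ℕ) : ‖z ^ j - 1‖ ≤ j * ‖z - 1‖ := by
  induction j with
  | zero => simp
  | succ j ih =>
    have h : z ^ (j + 1) - 1 = z * (z ^ j - 1) + (z - 1) := by ring
    calc ‖z ^ (j + 1) - 1‖ ≤ ‖z * (z ^ j - 1)‖ + ‖z - 1‖ := by rw [h]; exact norm_add_le _ _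
      _ ≤ j * ‖z - 1‖ + ‖z - 1‖ := by rw [norm_mul, hz, one_mul]; gcongr
      _ = ((j + 1 : ℕ) : ℝ) * ‖z - 1‖ := by push_cast; ring

/-- Decay away from 1: the geometric sum telescopes against z - 1. -/
lemma norm_kern_mul_le {z : ℂ} (hz : ‖z‖ = 1) (n : ℕ) : ‖kern n z‖ * ‖z - 1‖ ≤ 2 := by
  rw [← norm_mul, kern, geom_sum_mul]
  calc ‖z ^ n - 1‖ ≤ ‖z ^ n‖ + ‖(1 : ℂ)‖ := norm_sub_le _ _
    _ = 2 := by rw [norm_pow, hz]; norm_num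

/-- The peak at 1: the j-th power drifts from 1 by at most j‖z - 1‖, and these drifts add up to at
most n/2, so half of the trivial value n survives. -/
lemma half_le_norm_kern {z : ℂ} (hz : ‖z‖ = 1) (n : ℕ) (h : n * ‖z - 1‖ ≤ 1) :
    (n : ℝ) / 2 ≤ ‖kern n z‖ := by
  have h1 : ‖kern n z - n‖ ≤ n / 2 := by
    have h2 : kern n z - n = ∑ j ∈ Finset.range n, (z ^ j - 1) := by
      simp [kern]
    have hs : (∑ j ∈ Finset.range n, (j : ℝ)) ≤ n * n / 2 := by
      have h3 := Finset.sum_range_id_mul_two n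
      have h4 : (∑ j ∈ Finset.range n, j) * 2 ≤ n * n := by
        rw [h3]; exact Nat.mul_le_mul_left _ (Nat.sub_le _ _)
      have h5 : (((∑ j ∈ Finset.range n, j) * 2 : ℕ) : ℝ) ≤ ((n * n : ℕ) : ℝ) := by
        exact_mod_cast h4
      push_cast at h5
      linarith
    calc ‖kern n z - n‖ ≤ ∑ j ∈ Finset.range n, ‖z ^ j - 1‖ := by rw [h2]; exact norm_sum_le _ _
      _ ≤ ∑ j ∈ Finset.range n, (j : ℝ) * ‖z - 1‖ :=
        Finset.sum_le_sum fun j _ => norm_pow_sub_one_le hz j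
      _ = (∑ j ∈ Finset.range n, (j : ℝ)) * ‖z - 1‖ := by rw [Finset.sum_mul]
      _ ≤ (n * n / 2) * ‖z - 1‖ := by gcongr
      _ = n / 2 * (n * ‖z - 1‖) := by ring
      _ ≤ n / 2 * 1 := by gcongr
      _ = n / 2 := by ring
  have h2 : (n : ℝ) ≤ ‖kern n z‖ + ‖kern n z - n‖ := by
    calc (n : ℝ) = ‖kern n z - (kern n z - n)‖ := by simp
      _ ≤ _ := norm_sub_le _ _
  linarith

/-! ### Roots of unity and the discrete Fourier transform -/

/-- The primitive `L`-th root of unity `exp (2πi / L)`. -/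
def unityRoot (L : ℕ) : ℂ := Complex.exp (2 * Real.pi * Complex.I / L)

lemma unityRoot_isPrimitiveRoot (L : ℕ) [NeZero L] : IsPrimitiveRoot (unityRoot L) L :=
  Complex.isPrimitiveRoot_exp L (NeZero.ne L)

lemma norm_unityRoot (L : ℕ) : ‖unityRoot L‖ = 1 := by
  have h : unityRoot L = Complex.exp ((2 * Real.pi / L : ℝ) * Complex.I) := by
    rw [unityRoot]; congr 1; push_cast; ring
  rw [h, Complex.norm_exp_ofReal_mul_I]

lemma star_unityRoot (L : ℕ) : star (unityRoot L) = (unityRoot L)⁻¹ := by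
  rw [Complex.inv_eq_conj (norm_unityRoot L)]; rfl

/-- The unitary discrete Fourier transform. -/
def dft (L : ℕ) : Matrix (Fin L) (Fin L) ℂ :=
  Matrix.of fun y w => (unityRoot L ^ (y : ℕ)) ^ (w : ℕ) / (Real.sqrt L : ℂ)

lemma sum_pow_eq_ite (L : ℕ) [NeZero L] (w w' : Fin L) :
    ∑ y : Fin L, (unityRoot L ^ (w' : ℕ) / unityRoot L ^ (w : ℕ)) ^ (y : ℕ) =
      if w = w' then (L : ℂ) else 0 := by
  have hω := unityRoot_isPrimitiveRoot L
  have h0 : unityRoot L ≠ 0 := hω.ne_zero (NeZero.ne L)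
  split_ifs with h
  · subst h
    simp [div_self (pow_ne_zero _ h0)]
  · set q := unityRoot L ^ (w' : ℕ) / unityRoot L ^ (w : ℕ) with hq
    have hq1 : q ≠ 1 := by
      intro h1
      rw [hq, div_eq_one_iff_eq (pow_ne_zero _ h0)] at h1
      exact h (Fin.ext (hω.pow_inj w'.2 w.2 h1).symm)
    have hqL : q ^ L = 1 := by
      rw [hq, div_pow, ← pow_mul, ← pow_mul, mul_comm, pow_mul, mul_comm (w : ℕ), pow_mul,
        hω.pow_eq_one, one_pow, one_pow, div_one]
    rw [Fin.sum_univ_eq_sum_range (fun y => q ^ y) L]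
    have := geom_sum_mul q L
    rw [hqL, sub_self] at this
    exact (mul_eq_zero.mp this).resolve_right (sub_ne_zero.mpr hq1)

lemma dft_mem_unitary (L : ℕ) [NeZero L] : dft L ∈ Matrix.unitaryGroup (Fin L) ℂ := by
  rw [Matrix.mem_unitaryGroup_iff']
  ext w w'
  have hL : (L : ℂ) ≠ 0 := Nat.cast_ne_zero.mpr (NeZero.ne L)
  have hs : ((Real.sqrt L : ℝ) : ℂ) * (Real.sqrt L : ℝ) = L := by
    rw [← Complex.ofReal_mul, Real.mul_self_sqrt (Nat.cast_nonneg L)]; simp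
  rw [Matrix.mul_apply, Matrix.one_apply]
  have key : ∀ y : Fin L, star (dft L) w y * dft L y w' =
      (unityRoot L ^ (w' : ℕ) / unityRoot L ^ (w : ℕ)) ^ (y : ℕ) / L := by
    intro y
    simp only [Matrix.star_apply, dft, Matrix.of_apply, star_div₀, star_pow, star_unityRoot]
    have : star ((Real.sqrt L : ℝ) : ℂ) = (Real.sqrt L : ℝ) := Complex.conj_ofReal _
    rw [this, div_mul_div_comm, hs]
    congr 1
    rw [div_pow, div_eq_mul_inv, mul_comm, ← pow_mul, ← pow_mul, ← pow_mul, ← pow_mul, inv_pow,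
      mul_comm (y : ℕ), mul_comm (y : ℕ)]
  rw [Finset.sum_congr rfl fun y _ => key y, ← Finset.sum_div, sum_pow_eq_ite]
  split_ifs <;> simp [hL]

lemma sum_norm_sq_mulVec {ι : Type*} [Fintype ι] [DecidableEq ι] {U : Matrix ι ι ℂ}
    (hU : U ∈ Matrix.unitaryGroup ι ℂ) (v : ι → ℂ) :
    ∑ i, ‖(U *ᵥ v) i‖ ^ 2 = ∑ i, ‖v i‖ ^ 2 := by
  have h : ∀ u : ι → ℂ, star u ⬝ᵥ u = ((∑ i, ‖u i‖ ^ 2 : ℝ) : ℂ) := by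
    intro u
    rw [dotProduct]
    push_cast
    exact Finset.sum_congr rfl fun i _ => Complex.conj_mul' (u i)
  have h2 : star (U *ᵥ v) ⬝ᵥ (U *ᵥ v) = star v ⬝ᵥ v := by
    rw [Matrix.star_mulVec, ← Matrix.dotProduct_mulVec, Matrix.mulVec_mulVec,
      ← Matrix.star_eq_conjTranspose, Matrix.mem_unitaryGroup_iff'.mp hU, Matrix.one_mulVec]
  rw [h, h] at h2
  exact_mod_cast h2

/-- Parseval's identity on a rotated grid of roots of unity. -/
lemma parseval_grid (L : ℕ) [NeZero L] (a : Fin L → ℂ) {ζ : ℂ} (hζ : ‖ζ‖ = 1) :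
    ∑ y : Fin L, ‖∑ w, a w * (ζ * unityRoot L ^ (y : ℕ)) ^ (w : ℕ)‖ ^ 2 =
      L * ∑ w, ‖a w‖ ^ 2 := by
  have hL : (0 : ℝ) < L := Nat.cast_pos.mpr (NeZero.pos L)
  have h := sum_norm_sq_mulVec (dft_mem_unitary L) (fun w => a w * ζ ^ (w : ℕ))
  have h1 : ∀ y, ‖(dft L *ᵥ fun w => a w * ζ ^ (w : ℕ)) y‖ ^ 2 =
      ‖∑ w, a w * (ζ * unityRoot L ^ (y : ℕ)) ^ (w : ℕ)‖ ^ 2 / L := by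
    intro y
    have : (dft L *ᵥ fun w => a w * ζ ^ (w : ℕ)) y =
        (∑ w, a w * (ζ * unityRoot L ^ (y : ℕ)) ^ (w : ℕ)) / (Real.sqrt L : ℂ) := by
      simp only [Matrix.mulVec, dotProduct, dft, Matrix.of_apply, Finset.sum_div]
      refine Finset.sum_congr rfl fun w _ => ?_
      rw [mul_pow]; ring
    rw [this, norm_div, div_pow, Complex.norm_real, Real.norm_eq_abs, sq_abs,
      Real.sq_sqrt hL.le]
  simp only [h1, ← Finset.sum_div, norm_mul, norm_pow, hζ, one_pow, mul_one] at h
  field_simp at h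
  linarith

/-- An arc of half-width `r` contains its share of the points of a fine grid on the circle. -/
lemma le_card_near (L : ℕ) [NeZero L] (φ r : ℝ) (hr : r ≤ 1) (h : 2 * Real.pi ≤ L * r) :
    L * r / (2 * Real.pi) ≤ ((Finset.univ.filter fun y : Fin L =>
      ‖Complex.exp (φ * Complex.I) * unityRoot L ^ (y : ℕ) - 1‖ ≤ r).card : ℝ) := by
  have hL : (0 : ℝ) < L := Nat.cast_pos.mpr (NeZero.pos L)
  have hLz : (0 : ℤ) < L := by exact_mod_cast NeZero.pos L
  have hpi := Real.pi_pos
  have hr0 : 0 < r := by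
    by_contra hn
    have : (L : ℝ) * r ≤ 0 := mul_nonpos_of_nonneg_of_nonpos hL.le (not_lt.mp hn)
    linarith
  -- Grid angles are spaced 2π/L, so an interval of length 2r has room for k consecutive ones,
  -- starting at the first index a whose angle is at least -r. The bound k ≤ L keeps them distinct
  -- modulo L.
  set k := ⌊(L : ℝ) * r / Real.pi⌋₊ with hk
  set a := ⌈-(φ + r) * L / (2 * Real.pi)⌉ with ha
  have hk1 : (k : ℝ) ≤ L * r / Real.pi := Nat.floor_le (by positivity)
  have hk2 : L * r / Real.pi < k + 1 := Nat.lt_floor_add_one _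
  have ha1 : -(φ + r) * L / (2 * Real.pi) ≤ a := Int.le_ceil _
  have ha2 : (a : ℝ) < -(φ + r) * L / (2 * Real.pi) + 1 := Int.ceil_lt_add_one _
  have hkL : k ≤ L := by
    have : (k : ℝ) ≤ L := by
      refine hk1.trans ?_
      rw [div_le_iff₀ hpi]
      have := Real.pi_gt_three
      nlinarith
    exact_mod_cast this
  let f : ℕ → Fin L := fun i => ⟨((a + i) % L).toNat, by
    have h1 := Int.emod_lt_of_pos (a + i) hLz
    have h2 := Int.emod_nonneg (a + i) hLz.ne'
    omega⟩
  have hf : ∀ i, (((f i : Fin L) : ℕ) : ℤ) = (a + i) % L := fun i =>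
    Int.toNat_of_nonneg (Int.emod_nonneg (a + i) hLz.ne')
  have hcard : k ≤ (Finset.univ.filter fun y : Fin L =>
      ‖Complex.exp (φ * Complex.I) * unityRoot L ^ (y : ℕ) - 1‖ ≤ r).card := by
    have : k = (Finset.range k).card := (Finset.card_range k).symm
    rw [this]
    refine Finset.card_le_card_of_injOn f ?_ ?_
    · intro i hi
      have hik : i + 1 ≤ k := Finset.mem_range.mp hi
      have hik' : (i : ℝ) + 1 ≤ k := by exact_mod_cast hik
      simp only [Finset.coe_filter, Finset.mem_univ, true_and, Set.mem_ofPred_eq]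
      have hω := unityRoot_isPrimitiveRoot L
      have h0 : unityRoot L ≠ 0 := hω.ne_zero (NeZero.ne L)
      have hz : unityRoot L ^ ((f i : Fin L) : ℕ) = unityRoot L ^ (a + i : ℤ) := by
        rw [← zpow_natCast, hf]
        conv_rhs => rw [← Int.emod_add_mul_ediv (a + i) L]
        rw [zpow_add₀ h0, zpow_mul, zpow_natCast, hω.pow_eq_one, one_zpow, mul_one]
      set x : ℝ := φ + 2 * Real.pi * (a + i) / L with hx
      have he : Complex.exp (φ * Complex.I) * unityRoot L ^ ((f i : Fin L) : ℕ) =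
          Complex.exp (Complex.I * x) := by
        rw [hz, unityRoot, ← Complex.exp_int_mul, ← Complex.exp_add]
        congr 1
        rw [hx]; push_cast; ring
      rw [he]
      refine Real.norm_exp_I_mul_ofReal_sub_one_le.trans ?_
      rw [Real.norm_eq_abs, abs_le]
      have e1 : 2 * Real.pi * ((a : ℝ) + i) / L = ((a : ℝ) + i) * (2 * Real.pi / L) := by ring
      have hc : 0 < 2 * Real.pi / L := by positivity
      have e2 : (-(φ + r) * L / (2 * Real.pi)) * (2 * Real.pi / L) = -(φ + r) := by
        field_simp
      have e3 : (L * r / Real.pi) * (2 * Real.pi / L) = 2 * r := by field_simp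
      have hi0 : (0 : ℝ) ≤ i := Nat.cast_nonneg i
      constructor
      · have : (-(φ + r) * L / (2 * Real.pi)) * (2 * Real.pi / L) ≤
            ((a : ℝ) + i) * (2 * Real.pi / L) :=
          mul_le_mul_of_nonneg_right (by linarith) hc.le
        rw [hx, e1]; linarith
      · have : ((a : ℝ) + i) * (2 * Real.pi / L) ≤
            (-(φ + r) * L / (2 * Real.pi) + L * r / Real.pi) * (2 * Real.pi / L) :=
          mul_le_mul_of_nonneg_right (by linarith) hc.le
        rw [add_mul (-(φ + r) * L / (2 * Real.pi)), e2, e3] at this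
        rw [hx, e1]; linarith
    · intro i hi i' hi' hii
      have hi1 : i < k := by simpa using hi
      have hi2 : i' < k := by simpa using hi'
      have h3 : (a + i) % L = (a + i') % (L : ℤ) := by rw [← hf, ← hf, hii]
      have h4 : (i : ℤ) ≡ i' [ZMOD L] := Int.ModEq.add_left_cancel' a h3
      have h5 : i ≡ i' [MOD L] := (Int.natCast_modEq_iff).mp h4
      exact Nat.ModEq.eq_of_lt_of_lt h5 (by omega) (by omega)
  have hcard' : (k : ℝ) ≤ ((Finset.univ.filter fun y : Fin L =>
      ‖Complex.exp (φ * Complex.I) * unityRoot L ^ (y : ℕ) - 1‖ ≤ r).card : ℝ) := by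
    exact_mod_cast hcard
  refine le_trans ?_ hcard'
  -- The floor loses less than 1, which is at most half of Lr/π by hypothesis; hence 2π in place of
  -- π.
  have e : (L : ℝ) * r / Real.pi = L * r / (2 * Real.pi) + L * r / (2 * Real.pi) := by
    field_simp; ring
  have : 1 ≤ L * r / (2 * Real.pi) := by rw [le_div_iff₀ (by positivity)]; linarith
  linarith

/-! ### Gates -/

section Gates

open scoped Kronecker

variable {N T d : ℕ}

/-- Every unit vector can be prepared from any basis state by a unitary. -/
lemma exists_unitary_mulVec_single {ι : Type*} [Fintype ι] [DecidableEq ι] (v : ι → ℂ)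
    (hv : ∑ i, ‖v i‖ ^ 2 = 1) (i₀ : ι) :
    ∃ U : Matrix.unitaryGroup ι ℂ, (U : Matrix ι ι ℂ) *ᵥ Pi.single i₀ 1 = v := by
  have hn : ‖(WithLp.toLp 2 v : EuclideanSpace ℂ ι)‖ = 1 := by
    rw [EuclideanSpace.norm_eq, Real.sqrt_eq_one]; exact hv
  -- The vector becomes the member at `i₀` of an orthonormal basis; the unitary is the matrix of
  -- that basis.
  have ho : Orthonormal ℂ (({i₀} : Set ι).domRestrict
      fun _ => (WithLp.toLp 2 v : EuclideanSpace ℂ ι)) := by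
    rw [orthonormal_iff_ite]
    rintro ⟨i, rfl⟩ ⟨j, rfl⟩
    simp [inner_self_eq_norm_sq_to_K, hn]
  obtain ⟨b, hb⟩ := ho.exists_orthonormalBasis_extension_of_card_eq (by simp)
  refine ⟨⟨_, (EuclideanSpace.basisFun ι ℂ).toMatrix_orthonormalBasis_mem_unitary b⟩, ?_⟩
  ext i
  simp [Module.Basis.toMatrix_apply, hb i₀ rfl]

lemma diagonal_mul_submatrix_mem_unitary {ι : Type*} [Fintype ι] [DecidableEq ι] (s : ι → ℂ)
    (hs : ∀ i, ‖s i‖ = 1) (e : ι ≃ ι) :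
    Matrix.diagonal s * (1 : Matrix ι ι ℂ).submatrix e id ∈ Matrix.unitaryGroup ι ℂ := by
  refine mul_mem ?_ ?_
  · rw [Matrix.mem_unitaryGroup_iff, Matrix.star_eq_conjTranspose,
      Matrix.diagonal_conjTranspose, Matrix.diagonal_mul_diagonal, ← Matrix.diagonal_one]
    congr 1
    ext i
    have := Complex.mul_conj' (s i)
    rw [hs] at this
    simpa using this
  · rw [Matrix.mem_unitaryGroup_iff, Matrix.star_eq_conjTranspose,
      Matrix.conjTranspose_submatrix, Matrix.conjTranspose_one]
    ext i j
    simp [Matrix.mul_apply, Matrix.one_apply]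

/-- The sign flip on marked answers, active while the workspace counter exceeds `j`. -/
def markSign (S : Finset (Fin N)) (j : ℕ) (β : Fin N) (w : Fin (d + 1)) : ℂ :=
  if β ∈ S ∧ j < (w : ℕ) then -1 else 1

lemma norm_markSign (S : Finset (Fin N)) (j : ℕ) (β : Fin N) (w : Fin (d + 1)) :
    ‖markSign S j β w‖ = 1 := by
  unfold markSign; split_ifs <;> simp

/-- Negation of the answer register, as a permutation of the basis labels. -/
def negAnswer [NeZero N] : Basis N T d ≃ Basis N T d :=
  (Equiv.refl (Fin T)).prodCongr ((Equiv.neg (Fin N)).prodCongr (Equiv.refl (Fin (d + 1))))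

/-- Flip the sign of marked answers, then negate the answer register. -/
def markGate [NeZero N] (S : Finset (Fin N)) (j : ℕ) : Matrix.unitaryGroup (Basis N T d) ℂ :=
  ⟨_, diagonal_mul_submatrix_mem_unitary
    (fun x : Basis N T d => markSign S j (-x.2.1) x.2.2) (fun _ => norm_markSign _ _ _ _)
    negAnswer⟩

lemma markGate_mulVec [NeZero N] (S : Finset (Fin N)) (j : ℕ) (v : Basis N T d → ℂ)
    (t : Fin T) (β : Fin N) (w : Fin (d + 1)) :
    ((markGate S j : Matrix.unitaryGroup (Basis N T d) ℂ) : Matrix _ _ ℂ).mulVec v (t, β, w) =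
      markSign S j (-β) w * v (t, -β, w) := by
  simp only [markGate, ← Matrix.mulVec_mulVec, Matrix.mulVec_diagonal]
  congr 1
  simp [Matrix.mulVec, dotProduct, Matrix.one_apply, negAnswer]

/-- The reflection about the uniform superposition. -/
def reflection (T : ℕ) : Matrix (Fin T) (Fin T) ℂ :=
  Matrix.of (fun _ _ => (2 : ℂ) / T) - 1

lemma reflection_mem_unitary (T : ℕ) [NeZero T] :
    reflection T ∈ Matrix.unitaryGroup (Fin T) ℂ := by
  have hT : (T : ℂ) ≠ 0 := Nat.cast_ne_zero.mpr (NeZero.ne T)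
  have hs : star (reflection T) = reflection T := by
    ext i j
    simp [reflection, Matrix.star_apply, Matrix.one_apply, eq_comm]
  rw [Matrix.mem_unitaryGroup_iff, hs, reflection, sub_mul, mul_sub, mul_sub, mul_one, one_mul,
    mul_one]
  have : (Matrix.of (fun _ _ => (2 : ℂ) / T) : Matrix (Fin T) (Fin T) ℂ) *
      Matrix.of (fun _ _ => (2 : ℂ) / T) =
      Matrix.of (fun _ _ => (2 : ℂ) / T) + Matrix.of (fun _ _ => (2 : ℂ) / T) := by
    ext i j
    simp [Matrix.mul_apply]
    field_simp
    norm_num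
  rw [this]; abel

lemma reflection_mulVec (v : Fin T → ℂ) (t : Fin T) :
    (reflection T *ᵥ v) t = 2 / T * ∑ t', v t' - v t := by
  rw [reflection, Matrix.sub_mulVec, Matrix.one_mulVec]
  simp [Matrix.mulVec, dotProduct, Finset.mul_sum]

lemma blockDiagonal_mem_unitary {m o : Type*} [Fintype m] [DecidableEq m] [Fintype o]
    [DecidableEq o] (M : o → Matrix m m ℂ) (hM : ∀ k, M k ∈ Matrix.unitaryGroup m ℂ) :
    Matrix.blockDiagonal M ∈ Matrix.unitaryGroup (m × o) ℂ := by
  rw [Matrix.mem_unitaryGroup_iff, Matrix.star_eq_conjTranspose,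
    Matrix.blockDiagonal_conjTranspose, ← Matrix.blockDiagonal_mul, ← Matrix.blockDiagonal_one]
  congr 1
  ext1 k
  exact Matrix.mem_unitaryGroup_iff.mp (hM k)

/-- The reflection of the query register, active while the workspace counter exceeds `j`. -/
def reflectGate [NeZero T] (j : ℕ) : Matrix.unitaryGroup (Basis N T d) ℂ :=
  ⟨Matrix.blockDiagonal fun o : Fin N × Fin (d + 1) =>
      if j < (o.2 : ℕ) then reflection T else 1,
    blockDiagonal_mem_unitary _ fun o => by
      split_ifs
      exacts [reflection_mem_unitary T, one_mem _]⟩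

lemma reflectGate_mulVec [NeZero T] (j : ℕ) (v : Basis N T d → ℂ)
    (t : Fin T) (β : Fin N) (w : Fin (d + 1)) :
    ((reflectGate j : Matrix.unitaryGroup (Basis N T d) ℂ) : Matrix _ _ ℂ).mulVec v (t, β, w) =
      if j < (w : ℕ) then 2 / T * ∑ t', v (t', β, w) - v (t, β, w) else v (t, β, w) := by
  have : ((reflectGate j : Matrix.unitaryGroup (Basis N T d) ℂ) : Matrix _ _ ℂ).mulVec v
      (t, β, w) = ((if j < (w : ℕ) then reflection T else 1) *ᵥ fun t' => v (t', β, w)) t := by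
    simp only [reflectGate, Matrix.mulVec, dotProduct]
    rw [Fintype.sum_prod_type]
    refine Finset.sum_congr rfl fun t' _ => ?_
    simp [Matrix.blockDiagonal_apply']
  rw [this]
  split_ifs
  · exact reflection_mulVec _ _
  · simp

/-- The discrete Fourier transform of the workspace. -/
def dftGate : Matrix.unitaryGroup (Basis N T d) ℂ :=
  ⟨(1 : Matrix (Fin T) (Fin T) ℂ) ⊗ₖ ((1 : Matrix (Fin N) (Fin N) ℂ) ⊗ₖ dft (d + 1)),
    Matrix.kronecker_mem_unitary (one_mem _)
      (Matrix.kronecker_mem_unitary (one_mem _) (dft_mem_unitary (d + 1)))⟩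

lemma dftGate_mulVec (v : Basis N T d → ℂ) (t : Fin T) (β : Fin N) (y : Fin (d + 1)) :
    ((dftGate : Matrix.unitaryGroup (Basis N T d) ℂ) : Matrix _ _ ℂ).mulVec v (t, β, y) =
      ∑ w, dft (d + 1) y w * v (t, β, w) := by
  simp only [dftGate, Matrix.mulVec, dotProduct]
  rw [Fintype.sum_prod_type, Finset.sum_eq_single t, Fintype.sum_prod_type,
    Finset.sum_eq_single β]
  · simp
  · intro b _ hb; simp [hb.symm]
  · simp
  · intro b _ hb; simp [hb.symm]
  · simp

lemma oracle_mulVec [NeZero N] (O : Fin T → Fin N) (v : Basis N T d → ℂ)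
    (t : Fin T) (β : Fin N) (w : Fin (d + 1)) :
    (oracle O d *ᵥ v) (t, β, w) = v (t, β - O t, w) := by
  simp only [Matrix.mulVec, dotProduct, oracle]
  rw [Finset.sum_eq_single (t, β - O t, w)]
  · simp
  · rintro ⟨t', β', w'⟩ _ hne
    rw [if_neg, zero_mul]
    rintro h
    simp only [Prod.mk.injEq] at h
    obtain ⟨rfl, rfl, rfl⟩ := h
    simp at hne
  · simp

end Gates

/-! ### The window -/

open Polynomial in
/-- The window polynomial `(1 + X + ⋯ + X ^ (n - 1)) ^ K`. -/
def windowPoly (n K : ℕ) : ℂ[X] := (∑ j ∈ Finset.range n, Polynomial.X ^ j) ^ K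

lemma windowPoly_eval (n K : ℕ) (z : ℂ) : (windowPoly n K).eval z = kern n z ^ K := by
  simp [windowPoly, kern, Polynomial.eval_finsetSum]

lemma windowPoly_natDegree_le (n K : ℕ) : (windowPoly n K).natDegree ≤ K * (n - 1) := by
  refine Polynomial.natDegree_pow_le.trans (Nat.mul_le_mul_left _ ?_)
  refine Polynomial.natDegree_sum_le_of_forall_le _ _ fun j hj => ?_
  rw [Polynomial.natDegree_X_pow]
  have := Finset.mem_range.mp hj
  omega

lemma windowPoly_coeff_zero {n : ℕ} (hn : 0 < n) (K : ℕ) : (windowPoly n K).coeff 0 = 1 := by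
  rw [Polynomial.coeff_zero_eq_eval_zero, windowPoly_eval, kern,
    Finset.sum_eq_single_of_mem 0 (Finset.mem_range.mpr hn) (fun j _ hj => by simp [hj])]
  simp

/-- The squared norm of the vector of window coefficients on `d + 1` points. -/
def windowMass (n K d : ℕ) : ℝ := ∑ w : Fin (d + 1), ‖(windowPoly n K).coeff w‖ ^ 2

lemma windowMass_pos {n : ℕ} (hn : 0 < n) (K d : ℕ) : 0 < windowMass n K d := by
  refine Finset.sum_pos' (fun _ _ => by positivity) ⟨0, Finset.mem_univ _, ?_⟩
  simp [windowPoly_coeff_zero hn]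

/-- The normalised window amplitudes. -/
def window (n K d : ℕ) (w : Fin (d + 1)) : ℂ :=
  (windowPoly n K).coeff w / (Real.sqrt (windowMass n K d) : ℝ)

lemma sum_norm_sq_window {n : ℕ} (hn : 0 < n) (K d : ℕ) :
    ∑ w, ‖window n K d w‖ ^ 2 = 1 := by
  have h := windowMass_pos hn K d
  simp only [window, norm_div, div_pow, Complex.norm_real, Real.norm_eq_abs, sq_abs,
    Real.sq_sqrt h.le]
  rw [← Finset.sum_div]
  exact div_self h.ne'

/-- The degree bound says that the counter is large enough to hold every coefficient, so nothing is
truncated. -/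
lemma sum_windowPoly_coeff {n K d : ℕ} (h : K * (n - 1) ≤ d) (z : ℂ) :
    ∑ w : Fin (d + 1), (windowPoly n K).coeff w * z ^ (w : ℕ) = kern n z ^ K := by
  rw [← windowPoly_eval, Polynomial.eval_eq_sum_range'
    (Nat.lt_succ_of_le ((windowPoly_natDegree_le n K).trans h)),
    ← Fin.sum_univ_eq_sum_range (fun w => (windowPoly n K).coeff w * z ^ w)]

lemma window_eq_zero {n K d : ℕ} {w : Fin (d + 1)} (h : K * (n - 1) < w) :
    window n K d w = 0 := by
  rw [window, Polynomial.coeff_eq_zero_of_natDegree_lt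
    ((windowPoly_natDegree_le n K).trans_lt h), zero_div]

/-! ### The algorithm -/

section Algorithm

variable {N T : ℕ} [NeZero N] [NeZero T] {d : ℕ}

/-- The initial superposition: uniform queries, zero answer, window amplitudes in the workspace. -/
def prepVec (n K : ℕ) (x : Basis N T d) : ℂ :=
  if x.2.1 = 0 then window (n + 1) K d x.2.2 * (1 / Real.sqrt T : ℝ) else 0

lemma sum_norm_sq_prepVec (n K : ℕ) :
    ∑ x : Basis N T d, ‖prepVec n K x‖ ^ 2 = 1 := by
  have hT : (0 : ℝ) < T := Nat.cast_pos.mpr (NeZero.pos T)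
  rw [Fintype.sum_prod_type]
  have : ∀ t : Fin T, ∑ y : Fin N × Fin (d + 1), ‖prepVec n K ((t, y) : Basis N T d)‖ ^ 2 =
      1 / T := by
    intro t
    rw [Fintype.sum_prod_type, Finset.sum_eq_single 0]
    · simp only [prepVec, if_true, norm_mul, mul_pow, ← Finset.sum_mul,
        sum_norm_sq_window (Nat.succ_pos n)]
      rw [Complex.norm_real, Real.norm_eq_abs, sq_abs, div_pow, Real.sq_sqrt hT.le]
      ring
    · intro b _ hb; simp [prepVec, hb]
    · simp
  rw [Finset.sum_congr rfl fun t _ => this t]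
  simp [hT.ne']

/-- A unitary preparing `prepVec`. -/
def prepGate (n K : ℕ) : Matrix.unitaryGroup (Basis N T d) ℂ :=
  (exists_unitary_mulVec_single (prepVec n K) (sum_norm_sq_prepVec n K) (0, 0, 0)).choose

lemma prepGate_mulVec (n K : ℕ) :
    ((prepGate n K : Matrix.unitaryGroup (Basis N T d) ℂ) :
      Matrix (Basis N T d) (Basis N T d) ℂ) *ᵥ
      Pi.single ((0, 0, 0) : Basis N T d) 1 = prepVec n K :=
  (exists_unitary_mulVec_single (prepVec n K) (sum_norm_sq_prepVec n K) (0, 0, 0)).choose_spec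

/-- The gates of the counter-controlled Grover iteration; one iteration takes two queries. -/
def groverGate (S : Finset (Fin N)) (n K : ℕ) : ℕ → Matrix.unitaryGroup (Basis N T d) ℂ
  | 0 => prepGate n K
  | k + 1 => if Even k then markGate S (k / 2) else reflectGate (k / 2)

/-- Windowed amplitude estimation with `M` queries: counter-controlled Grover iterations, followed
by a discrete Fourier transform of the counter. -/
def amplitudeEstimation (S : Finset (Fin N)) (n K d M : ℕ) : QueryAlgorithm N T where
  queries := M
  work := d
  gate k := if k = M then dftGate * groverGate S n K k else groverGate S n K k
  output x := Real.sin (Real.pi * (x.2.2 : ℕ) / (d + 1 : ℕ)) ^ 2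

/-- The state after `k` queries of the circuit with the given gates. -/
def run (gate : ℕ → Matrix.unitaryGroup (Basis N T d) ℂ) (O : Fin T → Fin N) :
    ℕ → (Basis N T d → ℂ)
  | 0 => (gate 0 : Matrix (Basis N T d) (Basis N T d) ℂ) *ᵥ
      Pi.single ((0, 0, 0) : Basis N T d) 1
  | k + 1 => (gate (k + 1) : Matrix (Basis N T d) (Basis N T d) ℂ) *ᵥ
      (oracle O d *ᵥ run gate O k)

lemma outputProb_mk (M : ℕ) (gate : ℕ → Matrix.unitaryGroup (Basis N T d) ℂ)
    (output : Basis N T d → ℝ) (O : Fin T → Fin N) (E : Set ℝ) [DecidablePred (· ∈ E)] :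
    (QueryAlgorithm.mk M d gate output).outputProb O E =
      ∑ x, if output x ∈ E then ‖run gate O M x‖ ^ 2 else 0 := by
  have h : ∀ k, (QueryAlgorithm.mk M d gate output).stateAfter O k = run gate O k := by
    intro k
    induction k with
    | zero => rfl
    | succ k ih => rw [QueryAlgorithm.stateAfter, ih]; rfl
  unfold QueryAlgorithm.outputProb QueryAlgorithm.finalState
  simp only [h]

lemma run_congr {gate gate' : ℕ → Matrix.unitaryGroup (Basis N T d) ℂ} (O : Fin T → Fin N)
    (k : ℕ) (h : ∀ i ≤ k, gate i = gate' i) : run gate O k = run gate' O k := by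
  induction k with
  | zero => rw [run, run, h 0 le_rfl]
  | succ k ih => rw [run, run, h _ le_rfl, ih fun i hi => h i (by omega)]

/-- Composing the last gate with a unitary applies that unitary to the final state. -/
lemma run_mul_last (gate : ℕ → Matrix.unitaryGroup (Basis N T d) ℂ)
    (U : Matrix.unitaryGroup (Basis N T d) ℂ) (O : Fin T → Fin N) (M : ℕ) :
    run (fun k => if k = M then U * gate k else gate k) O M =
      (U : Matrix (Basis N T d) (Basis N T d) ℂ) *ᵥ run gate O M := by
  rcases M with _ | M
  · rw [run, run, if_pos rfl, Matrix.UnitaryGroup.mul_val, ← Matrix.mulVec_mulVec]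
  · rw [run, run, if_pos rfl, Matrix.UnitaryGroup.mul_val, ← Matrix.mulVec_mulVec,
      run_congr (gate' := gate) O M fun i hi => if_neg (by omega)]

/-- The amplitudes on the query register after `m` Grover iterations. -/
def groverAmp (S : Finset (Fin N)) (O : Fin T → Fin N) : ℕ → Fin T → ℂ
  | 0, _ => (1 / Real.sqrt T : ℝ)
  | m + 1, t => 2 / T * ∑ t', (if O t' ∈ S then -1 else 1) * groverAmp S O m t' -
      (if O t ∈ S then -1 else 1) * groverAmp S O m t

/-- No inverse oracle is needed: the first query writes O(t), the mark gate negates it, and the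
second query adds O(t) again and clears the register. This also happens in branches w ≤ j, where
sign and reflection are switched off; hence `min j w` effective iterations. -/
lemma run_groverGate_even_odd (S : Finset (Fin N)) (n K : ℕ) (O : Fin T → Fin N) (j : ℕ) :
    (∀ t β w, run (groverGate (d := d) S n K) O (2 * j) (t, β, w) =
      if β = 0 then window (n + 1) K d w * groverAmp S O (min j w) t else 0) ∧
    (∀ t β w, run (groverGate (d := d) S n K) O (2 * j + 1) (t, β, w) =
      if β = - O t then markSign S j (O t) w *
        (window (n + 1) K d w * groverAmp S O (min j w) t) else 0) := by
  have step : ∀ j, (∀ t β w, run (groverGate (d := d) S n K) O (2 * j) (t, β, w) =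
      if β = 0 then window (n + 1) K d w * groverAmp S O (min j w) t else 0) →
      (∀ t β w, run (groverGate (d := d) S n K) O (2 * j + 1) (t, β, w) =
      if β = - O t then markSign S j (O t) w *
        (window (n + 1) K d w * groverAmp S O (min j w) t) else 0) := by
    intro j hj t β w
    have he : Even (2 * j) := even_two_mul j
    have hdiv : 2 * j / 2 = j := by omega
    rw [run, groverGate, if_pos he, hdiv, markGate_mulVec, oracle_mulVec, hj]
    by_cases h : β = - O t
    · subst h
      simp
    · rw [if_neg h, if_neg, mul_zero]
      intro h'
      exact h (by rw [← sub_eq_zero.mp h', neg_neg])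
  induction j with
  | zero =>
    have h0 : ∀ t β w, run (groverGate (d := d) S n K) O (2 * 0) (t, β, w) =
        if β = 0 then window (n + 1) K d w * groverAmp S O (min 0 w) t else 0 := by
      intro t β w
      rw [Nat.mul_zero, run, groverGate, prepGate_mulVec]
      simp [prepVec, groverAmp]
    exact ⟨h0, step 0 h0⟩
  | succ j ih =>
    have h1 : ∀ t β w, run (groverGate (d := d) S n K) O (2 * (j + 1)) (t, β, w) =
        if β = 0 then window (n + 1) K d w * groverAmp S O (min (j + 1) w) t else 0 := by
      intro t β w
      have he : ¬ Even (2 * j + 1) := Nat.not_even_iff_odd.mpr (odd_two_mul_add_one j)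
      have hdiv : (2 * j + 1) / 2 = j := by omega
      have e : 2 * (j + 1) = 2 * j + 1 + 1 := by ring
      rw [e, run, groverGate, if_neg he, hdiv, reflectGate_mulVec]
      have hv : ∀ t', (oracle O d *ᵥ run (groverGate (d := d) S n K) O (2 * j + 1)) (t', β, w) =
          if β = 0 then markSign S j (O t') w *
            (window (n + 1) K d w * groverAmp S O (min j w) t') else 0 := by
        intro t'
        rw [oracle_mulVec, ih.2]
        congr 1
        rw [eq_iff_iff, sub_eq_neg_self]
      simp only [hv]
      by_cases hβ : β = 0
      · simp only [hβ, if_true]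
        split_ifs with hw
        · have m1 : min j (w : ℕ) = j := by omega
          have m2 : min (j + 1) (w : ℕ) = j + 1 := by omega
          simp only [m1, m2, groverAmp, markSign, hw, and_true]
          rw [mul_sub, Finset.mul_sum, Finset.mul_sum, Finset.mul_sum]
          congr 1
          · exact Finset.sum_congr rfl fun t' _ => by ring
          · ring
        · have m1 : min j (w : ℕ) = min (j + 1) w := by omega
          simp [markSign, hw, m1]
      · simp [hβ]
    exact ⟨h1, step _ h1⟩

/-- After all queries the answer register holds a function of the query register, and the counter
value `w` labels the state after `w` Grover iterations. -/
lemma exists_run_groverGate_eq (S : Finset (Fin N)) (n K M : ℕ) (O : Fin T → Fin N)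
    (h : K * n ≤ M / 2) :
    ∃ b : Fin T → Fin N, ∀ t β w, run (groverGate (d := d) S n K) O M (t, β, w) =
      if β = b t then window (n + 1) K d w * groverAmp S O w t else 0 := by
  -- The window is supported on w ≤ K n ≤ M/2, so no branch with nonzero amplitude is cut off by the
  -- query budget.
  have hw : ∀ w : Fin (d + 1), M / 2 < w → window (n + 1) K d w = 0 := fun w hw =>
    window_eq_zero (by simpa using lt_of_le_of_lt h hw)
  have key : ∀ (t : Fin T) (w : Fin (d + 1)),
      window (n + 1) K d w * groverAmp S O (min (M / 2) w) t =
        window (n + 1) K d w * groverAmp S O w t := by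
    intro t w
    by_cases hlt : M / 2 < w
    · simp [hw w hlt]
    · rw [min_eq_right (not_lt.mp hlt)]
  obtain ⟨h1, h2⟩ := run_groverGate_even_odd (d := d) S n K O (M / 2)
  rcases Nat.even_or_odd' M with ⟨j, hj | hj⟩
  · have hM : M / 2 = j := by omega
    refine ⟨fun _ => 0, fun t β w => ?_⟩
    rw [← key]
    conv_lhs => rw [hj, ← hM]
    exact h1 t β w
  · have hM : M / 2 = j := by omega
    refine ⟨fun t => - O t, fun t β w => ?_⟩
    rw [← key]
    conv_lhs => rw [hj, ← hM]
    rw [h2]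
    congr 1
    -- For odd M the leftover query belongs to iteration M/2, whose sign flip acts only on w > M/2,
    -- where the window vanishes.
    by_cases hlt : M / 2 < w
    · simp [hw w hlt]
    · simp [markSign, hlt]

/-- The probability that the output lies in `E`, in terms of the Grover amplitudes. -/
lemma outputProb_eq_sum (S : Finset (Fin N)) (n K M : ℕ) (O : Fin T → Fin N)
    (h : K * n ≤ M / 2) (E : Set ℝ) [DecidablePred (· ∈ E)] :
    (amplitudeEstimation S n K d M).outputProb O E =
      ∑ y : Fin (d + 1), if Real.sin (Real.pi * (y : ℕ) / (d + 1 : ℕ)) ^ 2 ∈ E then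
        ∑ t, ‖∑ w, dft (d + 1) y w * window (n + 1) K d w * groverAmp S O w t‖ ^ 2 else 0 := by
  obtain ⟨b, hb⟩ := exists_run_groverGate_eq (d := d) S n K M O h
  have hfin : ∀ (t : Fin T) (β : Fin N) (y : Fin (d + 1)),
      (((dftGate : Matrix.unitaryGroup (Basis N T d) ℂ) :
        Matrix (Basis N T d) (Basis N T d) ℂ) *ᵥ run (groverGate S n K) O M) (t, β, y) =
      if β = b t then ∑ w, dft (d + 1) y w * window (n + 1) K d w * groverAmp S O w t
        else 0 := by
    intro t β y
    rw [dftGate_mulVec]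
    simp only [hb]
    split_ifs
    · exact Finset.sum_congr rfl fun w _ => by ring
    · simp
  rw [amplitudeEstimation, outputProb_mk, run_mul_last, Fintype.sum_prod_type]
  have h1 : ∀ t : Fin T, ∑ x : Fin N × Fin (d + 1),
      (if Real.sin (Real.pi * (x.2 : ℕ) / (d + 1 : ℕ)) ^ 2 ∈ E then
        ‖(((dftGate : Matrix.unitaryGroup (Basis N T d) ℂ) :
          Matrix (Basis N T d) (Basis N T d) ℂ) *ᵥ run (groverGate S n K) O M) (t, x)‖ ^ 2
          else 0) =
      ∑ y : Fin (d + 1), if Real.sin (Real.pi * (y : ℕ) / (d + 1 : ℕ)) ^ 2 ∈ E then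
        ‖∑ w, dft (d + 1) y w * window (n + 1) K d w * groverAmp S O w t‖ ^ 2 else 0 := by
    intro t
    rw [Fintype.sum_prod_type, Finset.sum_eq_single (b t)]
    · refine Finset.sum_congr rfl fun y _ => ?_
      rw [hfin, if_pos rfl]
    · intro β _ hβ
      refine Finset.sum_eq_zero fun y _ => ?_
      rw [hfin, if_neg hβ]
      simp
    · simp
  rw [Finset.sum_congr rfl fun t _ => h1 t, Finset.sum_comm]
  refine Finset.sum_congr rfl fun y _ => ?_
  split_ifs <;> simp

end Algorithm

/-! ### Rotation in the Grover plane -/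

section Rotation

variable {N T : ℕ} [NeZero T]

lemma sum_mark (S : Finset (Fin N)) (O : Fin T → Fin N) {p : ℝ}
    (hp : p = ((Finset.univ.filter fun t => O t ∈ S).card : ℝ) / T) (a b : ℂ) :
    ∑ t, (if O t ∈ S then a else b) = T * (p * a + (1 - p) * b) := by
  have hT : (T : ℂ) ≠ 0 := Nat.cast_ne_zero.mpr (NeZero.ne T)
  have hc := Finset.card_filter_add_card_filter_not (s := (Finset.univ : Finset (Fin T)))
    (fun t => O t ∈ S)
  rw [Finset.card_univ, Fintype.card_fin] at hc
  have hc' : ((Finset.univ.filter fun t => ¬ O t ∈ S).card : ℂ) =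
      T - ((Finset.univ.filter fun t => O t ∈ S).card : ℂ) := by
    rw [eq_sub_iff_add_eq', ← Nat.cast_add, hc]
  rw [Finset.sum_ite, Finset.sum_const, Finset.sum_const, nsmul_eq_mul, nsmul_eq_mul, hc', hp]
  push_cast
  field_simp

/-- Induction on m by the addition formulas: sign flip followed by reflection adds 2θ to the angle
(2m + 1)θ. A divisor vanishes only when no sample lies in the branch that uses it. -/
lemma groverAmp_eq (S : Finset (Fin N)) (O : Fin T → Fin N) {θ : ℝ}
    (hθ : Real.sin θ ^ 2 = ((Finset.univ.filter fun t => O t ∈ S).card : ℝ) / T) (m : ℕ)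
    (t : Fin T) :
    groverAmp S O m t = (1 / Real.sqrt T : ℝ) *
      if O t ∈ S then ((Real.sin ((2 * m + 1) * θ) / Real.sin θ : ℝ) : ℂ)
        else ((Real.cos ((2 * m + 1) * θ) / Real.cos θ : ℝ) : ℂ) := by
  have hT : (0 : ℝ) < T := Nat.cast_pos.mpr (NeZero.pos T)
  have hTc : (T : ℂ) ≠ 0 := Nat.cast_ne_zero.mpr (NeZero.ne T)
  have hcosq : Real.cos θ ^ 2 = 1 - Real.sin θ ^ 2 := Real.cos_sq' θ
  have hsin : ∀ t, O t ∈ S → Real.sin θ ≠ 0 := by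
    intro t ht h0
    have : 0 < (Finset.univ.filter fun t => O t ∈ S).card :=
      Finset.card_pos.mpr ⟨t, by simpa using ht⟩
    have h2 : (0 : ℝ) < ((Finset.univ.filter fun t => O t ∈ S).card : ℝ) / T := by positivity
    rw [← hθ, h0] at h2
    norm_num at h2
  have hcos : ∀ t, O t ∉ S → Real.cos θ ≠ 0 := by
    intro t ht h0
    have h1 : Real.sin θ ^ 2 = 1 := by rw [h0] at hcosq; linarith
    rw [h1, eq_div_iff hT.ne', one_mul] at hθ
    have hlt : (Finset.univ.filter fun t => O t ∈ S).card < (Finset.univ : Finset (Fin T)).card :=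
      Finset.card_lt_card (Finset.filter_ssubset.mpr ⟨t, Finset.mem_univ _, ht⟩)
    rw [Finset.card_univ, Fintype.card_fin] at hlt
    have : ((Finset.univ.filter fun t => O t ∈ S).card : ℝ) < T := by exact_mod_cast hlt
    linarith
  induction m generalizing t with
  | zero =>
    rw [groverAmp]
    split_ifs with h
    · simp [div_self (hsin t h)]
    · simp [div_self (hcos t h)]
  | succ m ih =>
    set a : ℝ := Real.sin ((2 * m + 1) * θ) with ha
    set b : ℝ := Real.cos ((2 * m + 1) * θ) with hb
    have hsum : ∑ t', (if O t' ∈ S then -1 else 1) * groverAmp S O m t' =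
        (1 / Real.sqrt T : ℝ) * (T * ((Real.cos θ * b - Real.sin θ * a : ℝ) : ℂ)) := by
      have h1 : ∀ t', (if O t' ∈ S then -1 else 1) * groverAmp S O m t' =
          (1 / Real.sqrt T : ℝ) * if O t' ∈ S then ((-(a / Real.sin θ) : ℝ) : ℂ)
            else ((b / Real.cos θ : ℝ) : ℂ) := by
        intro t'
        rw [ih]
        split_ifs <;> simp
      rw [Finset.sum_congr rfl fun t' _ => h1 t', ← Finset.mul_sum, sum_mark S O hθ]
      congr 2
      rw [← Complex.ofReal_one, ← Complex.ofReal_sub, ← Complex.ofReal_mul, ← Complex.ofReal_mul,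
        ← Complex.ofReal_add, ← hcosq]
      congr 1
      have e1 : Real.sin θ ^ 2 * (a / Real.sin θ) = Real.sin θ * a := by
        by_cases h : Real.sin θ = 0
        · simp [h]
        · field_simp
      have e2 : Real.cos θ ^ 2 * (b / Real.cos θ) = Real.cos θ * b := by
        by_cases h : Real.cos θ = 0
        · simp [h]
        · field_simp
      rw [mul_neg, e1, e2]; ring
    rw [groverAmp, hsum, ih]
    have r1 : (2 : ℂ) / T * ((1 / Real.sqrt T : ℝ) *
        (T * ((Real.cos θ * b - Real.sin θ * a : ℝ) : ℂ))) =
        (1 / Real.sqrt T : ℝ) * ((2 * (Real.cos θ * b - Real.sin θ * a) : ℝ) : ℂ) := by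
      push_cast
      field_simp
    have ang : (2 * ((m + 1 : ℕ) : ℝ) + 1) * θ = (2 * m + 1) * θ + 2 * θ := by push_cast; ring
    have s2 := Real.sin_two_mul θ
    have c2 := Real.cos_two_mul θ
    rw [r1]
    split_ifs with h
    · have h0 := hsin t h
      have : 2 * (Real.cos θ * b - Real.sin θ * a) + a / Real.sin θ =
          Real.sin ((2 * ((m + 1 : ℕ) : ℝ) + 1) * θ) / Real.sin θ := by
        rw [ang, Real.sin_add, s2, c2, hcosq, ← ha, ← hb]
        field_simp
        ring
      rw [← this]
      push_cast
      ring
    · have h0 := hcos t h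
      have : 2 * (Real.cos θ * b - Real.sin θ * a) - b / Real.cos θ =
          Real.cos ((2 * ((m + 1 : ℕ) : ℝ) + 1) * θ) / Real.cos θ := by
        rw [ang, Real.cos_add, s2, c2, ← ha, ← hb]
        field_simp
        ring
      rw [← this]
      push_cast
      ring

/-- The counter distribution is an equal mixture over the two eigenphases `±2θ`. -/
lemma sum_norm_sq_groverAmp (S : Finset (Fin N)) (O : Fin T → Fin N) {θ : ℝ}
    (hθ : Real.sin θ ^ 2 = ((Finset.univ.filter fun t => O t ∈ S).card : ℝ) / T)
    (hθ0 : 0 ≤ θ) (hθ1 : θ ≤ Real.pi / 2) {d : ℕ} (g : Fin (d + 1) → ℂ) :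
    ∑ t, ‖∑ w, g w * groverAmp S O w t‖ ^ 2 =
      (‖∑ w, g w * Complex.exp ((2 * θ : ℝ) * Complex.I) ^ (w : ℕ)‖ ^ 2 +
        ‖∑ w, g w * Complex.exp ((2 * (-θ) : ℝ) * Complex.I) ^ (w : ℕ)‖ ^ 2) / 2 := by
  have hT : (0 : ℝ) < T := Nat.cast_pos.mpr (NeZero.pos T)
  set A : ℂ := ∑ w, g w * (Real.sin ((2 * (w : ℕ) + 1) * θ) : ℂ) with hA
  set B : ℂ := ∑ w, g w * (Real.cos ((2 * (w : ℕ) + 1) * θ) : ℂ) with hB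
  have h1 : ∀ t, ∑ w, g w * groverAmp S O w t = (1 / Real.sqrt T : ℝ) *
      if O t ∈ S then A / (Real.sin θ : ℂ) else B / (Real.cos θ : ℂ) := by
    intro t
    rw [Finset.sum_congr rfl fun (w : Fin (d + 1)) _ => by rw [groverAmp_eq S O hθ]]
    split_ifs
    · rw [hA, Finset.sum_div, Finset.mul_sum]
      exact Finset.sum_congr rfl fun w _ => by push_cast; ring
    · rw [hB, Finset.sum_div, Finset.mul_sum]
      exact Finset.sum_congr rfl fun w _ => by push_cast; ring
  have h2 : ∑ t, ‖∑ w, g w * groverAmp S O w t‖ ^ 2 = ‖A‖ ^ 2 + ‖B‖ ^ 2 := by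
    have h3 : ∀ t, ((‖∑ w, g w * groverAmp S O w t‖ ^ 2 : ℝ) : ℂ) =
        if O t ∈ S then ((‖A‖ ^ 2 / Real.sin θ ^ 2 / T : ℝ) : ℂ)
          else ((‖B‖ ^ 2 / Real.cos θ ^ 2 / T : ℝ) : ℂ) := by
      intro t
      rw [h1, norm_mul, mul_pow, Complex.norm_real, Real.norm_eq_abs, sq_abs, div_pow,
        Real.sq_sqrt hT.le]
      split_ifs <;> rw [norm_div, div_pow, Complex.norm_real, Real.norm_eq_abs, sq_abs] <;>
        congr 1 <;> ring
    -- If sin θ = 0, division by zero gives 0 on the left; the range of θ forces θ = 0, so A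
    -- vanishes as well. The cosine case is analogous, with θ = π/2.
    have hs : Real.sin θ ^ 2 * (‖A‖ ^ 2 / Real.sin θ ^ 2) = ‖A‖ ^ 2 := by
      by_cases h : Real.sin θ = 0
      · have : θ = 0 := by
          rcases hθ0.eq_or_lt with h' | h'
          · exact h'.symm
          · have := Real.sin_pos_of_pos_of_lt_pi h' (by linarith [Real.pi_pos])
            linarith
        have hA0 : A = 0 := by rw [hA]; simp [this]
        simp [hA0]
      · field_simp
    have hc : Real.cos θ ^ 2 * (‖B‖ ^ 2 / Real.cos θ ^ 2) = ‖B‖ ^ 2 := by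
      by_cases h : Real.cos θ = 0
      · have : θ = Real.pi / 2 := by
          rcases hθ1.eq_or_lt with h' | h'
          · exact h'
          · have := Real.cos_pos_of_mem_Ioo ⟨by linarith [Real.pi_pos], h'⟩
            linarith
        have hB0 : B = 0 := by
          rw [hB]
          refine Finset.sum_eq_zero fun w _ => ?_
          have : Real.cos ((2 * (w : ℕ) + 1) * θ) = 0 := by
            rw [Real.cos_eq_zero_iff]
            exact ⟨(w : ℕ), by rw [this]; push_cast; ring⟩
          rw [this]; simp
        simp [hB0]
      · field_simp
    have h4 : ((∑ t, ‖∑ w, g w * groverAmp S O w t‖ ^ 2 : ℝ) : ℂ) =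
        ((‖A‖ ^ 2 + ‖B‖ ^ 2 : ℝ) : ℂ) := by
      rw [Complex.ofReal_sum, Finset.sum_congr rfl fun t _ => h3 t, sum_mark S O hθ, ← hs, ← hc,
        Real.cos_sq' θ, ← Real.cos_sq' θ, hs, hc]
      rw [← Complex.ofReal_one, ← Complex.ofReal_sub, ← Complex.ofReal_mul, ← Complex.ofReal_mul,
        ← Complex.ofReal_add, ← Complex.ofReal_natCast, ← Complex.ofReal_mul, ← Real.cos_sq' θ]
      congr 1
      nth_rewrite 2 [← hs]
      nth_rewrite 2 [← hc]
      field_simp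
    exact_mod_cast h4
  -- Up to unit factors the sums at phases ±2θ are B ± iA; the parallelogram law turns ‖A‖² + ‖B‖²
  -- into the mean of their squared norms.
  have hP : Complex.exp (θ * Complex.I) *
      ∑ w, g w * Complex.exp ((2 * θ : ℝ) * Complex.I) ^ (w : ℕ) = B + A * Complex.I := by
    rw [hA, hB, Finset.mul_sum, Finset.sum_mul, ← Finset.sum_add_distrib]
    refine Finset.sum_congr rfl fun w _ => ?_
    have : Complex.exp (θ * Complex.I) * Complex.exp ((2 * θ : ℝ) * Complex.I) ^ (w : ℕ) =
        Complex.exp (((2 * (w : ℕ) + 1) * θ : ℝ) * Complex.I) := by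
      rw [← Complex.exp_nat_mul, ← Complex.exp_add]
      congr 1; push_cast; ring
    rw [mul_left_comm, this, Complex.exp_mul_I, ← Complex.ofReal_cos, ← Complex.ofReal_sin]
    ring
  have hM : Complex.exp ((-θ : ℝ) * Complex.I) *
      ∑ w, g w * Complex.exp ((2 * (-θ) : ℝ) * Complex.I) ^ (w : ℕ) = B - A * Complex.I := by
    rw [hA, hB, Finset.mul_sum, Finset.sum_mul, ← Finset.sum_sub_distrib]
    refine Finset.sum_congr rfl fun w _ => ?_
    have : Complex.exp ((-θ : ℝ) * Complex.I) *
        Complex.exp ((2 * (-θ) : ℝ) * Complex.I) ^ (w : ℕ) =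
        Complex.exp ((-((2 * (w : ℕ) + 1) * θ) : ℝ) * Complex.I) := by
      rw [← Complex.exp_nat_mul, ← Complex.exp_add]
      congr 1; push_cast; ring
    rw [mul_left_comm, this, Complex.exp_mul_I, ← Complex.ofReal_cos, ← Complex.ofReal_sin,
      Real.cos_neg, Real.sin_neg]
    push_cast
    ring
  have nP : ‖∑ w, g w * Complex.exp ((2 * θ : ℝ) * Complex.I) ^ (w : ℕ)‖ =
      ‖B + A * Complex.I‖ := by
    rw [← hP, norm_mul, Complex.norm_exp_ofReal_mul_I, one_mul]
  have nM : ‖∑ w, g w * Complex.exp ((2 * (-θ) : ℝ) * Complex.I) ^ (w : ℕ)‖ =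
      ‖B - A * Complex.I‖ := by
    rw [← hM, norm_mul, Complex.norm_exp_ofReal_mul_I, one_mul]
  rw [h2, nP, nM]
  have := parallelogram_law_with_norm ℝ B (A * Complex.I)
  rw [norm_mul, Complex.norm_I, mul_one] at this
  linarith

end Rotation

/-! ### Concentration of the windowed kernel -/

/-- The point `exp (iφ) ω ^ y` of the rotated grid on the unit circle. -/
def gridPoint (L : ℕ) (φ : ℝ) (y : Fin L) : ℂ :=
  Complex.exp (φ * Complex.I) * unityRoot L ^ (y : ℕ)

lemma norm_gridPoint (L : ℕ) (φ : ℝ) (y : Fin L) : ‖gridPoint L φ y‖ = 1 := by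
  rw [gridPoint, norm_mul, Complex.norm_exp_ofReal_mul_I, norm_pow, norm_unityRoot]
  simp

/-- Parseval for a vector of n + 1 ones; the total does not depend on the phase. -/
lemma sum_norm_kern_sq (n d : ℕ) (hn : n ≤ d) (φ : ℝ) :
    ∑ y, ‖kern (n + 1) (gridPoint (d + 1) φ y)‖ ^ 2 = ((d + 1 : ℕ) : ℝ) * (n + 1) := by
  have h := parseval_grid (d + 1) (fun w => if (w : ℕ) ∈ Finset.range (n + 1) then 1 else 0)
    (Complex.norm_exp_ofReal_mul_I φ)
  have hsub : Finset.range (n + 1) ⊆ Finset.range (d + 1) :=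
    Finset.range_subset_range.mpr (by omega)
  have h1 : ∀ z : ℂ, ∑ w : Fin (d + 1),
      (if (w : ℕ) ∈ Finset.range (n + 1) then (1 : ℂ) else 0) * z ^ (w : ℕ) =
        kern (n + 1) z := by
    intro z
    rw [Fin.sum_univ_eq_sum_range
      (fun w => (if w ∈ Finset.range (n + 1) then (1 : ℂ) else 0) * z ^ w) (d + 1)]
    simp only [ite_mul, one_mul, zero_mul]
    rw [Finset.sum_ite_mem, Finset.inter_eq_right.mpr hsub, kern]
  have h2 : ∑ w : Fin (d + 1),
      ‖(if (w : ℕ) ∈ Finset.range (n + 1) then (1 : ℂ) else 0)‖ ^ 2 = n + 1 := by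
    rw [Fin.sum_univ_eq_sum_range
      (fun w => ‖(if w ∈ Finset.range (n + 1) then (1 : ℂ) else 0)‖ ^ 2) (d + 1)]
    have : ∀ w, ‖(if w ∈ Finset.range (n + 1) then (1 : ℂ) else 0)‖ ^ 2 =
        if w ∈ Finset.range (n + 1) then (1 : ℝ) else 0 := by
      intro w; split_ifs <;> simp
    simp only [this]
    rw [Finset.sum_ite_mem, Finset.inter_eq_right.mpr hsub]
    simp
  rw [h2] at h
  simp only [h1] at h
  exact h

/-- The unnormalised outcome weight of the grid point `y` at phase `φ`. -/
def kernWeight (n K d : ℕ) (φ : ℝ) (y : Fin (d + 1)) : ℝ :=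
  (‖kern (n + 1) (gridPoint (d + 1) φ y)‖ ^ 2) ^ K

lemma kernWeight_nonneg (n K d : ℕ) (φ : ℝ) (y : Fin (d + 1)) : 0 ≤ kernWeight n K d φ y := by
  unfold kernWeight; positivity

lemma sum_kernWeight {n K d : ℕ} (h : K * n ≤ d) (φ : ℝ) :
    ∑ y, kernWeight n K d φ y = ((d + 1 : ℕ) : ℝ) * windowMass (n + 1) K d := by
  have := parseval_grid (d + 1) (fun w => (windowPoly (n + 1) K).coeff w)
    (Complex.norm_exp_ofReal_mul_I φ)
  simp only [sum_windowPoly_coeff (n := n + 1) (K := K) (d := d) (by simpa using h)] at this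
  rw [windowMass, ← this]
  refine Finset.sum_congr rfl fun y _ => ?_
  rw [kernWeight, gridPoint, norm_pow, ← pow_mul, ← pow_mul, mul_comm 2 K]

/-- The weight near phase zero is at least the share of the arc times the peak. -/
lemma le_sum_kernWeight_near (n K d : ℕ) (φ r : ℝ) (hr : (n + 1) * r ≤ 1)
    (hL : 2 * Real.pi ≤ ((d + 1 : ℕ) : ℝ) * r) :
    ((d + 1 : ℕ) : ℝ) * r / (2 * Real.pi) * (((n : ℝ) + 1) ^ 2 / 4) ^ K ≤
      ∑ y with ‖gridPoint (d + 1) φ y - 1‖ ≤ r, kernWeight n K d φ y := by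
  have hr0 : 0 < r := by
    by_contra hn
    have : ((d + 1 : ℕ) : ℝ) * r ≤ 0 :=
      mul_nonpos_of_nonneg_of_nonpos (Nat.cast_nonneg _) (not_lt.mp hn)
    linarith [Real.pi_pos]
  have hr1 : r ≤ 1 := by
    have : (0 : ℝ) ≤ n * r := by positivity
    linarith
  have hc := le_card_near (d + 1) φ r hr1 hL
  calc ((d + 1 : ℕ) : ℝ) * r / (2 * Real.pi) * (((n : ℝ) + 1) ^ 2 / 4) ^ K
      ≤ ((Finset.univ.filter fun y : Fin (d + 1) =>
          ‖gridPoint (d + 1) φ y - 1‖ ≤ r).card : ℝ) * (((n : ℝ) + 1) ^ 2 / 4) ^ K := by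
        gcongr; exact hc
    _ = ∑ y : Fin (d + 1) with ‖gridPoint (d + 1) φ y - 1‖ ≤ r, (((n : ℝ) + 1) ^ 2 / 4) ^ K := by
        rw [Finset.sum_const, nsmul_eq_mul]
    _ ≤ _ := by
        refine Finset.sum_le_sum fun y hy => ?_
        have hy' : ‖gridPoint (d + 1) φ y - 1‖ ≤ r := (Finset.mem_filter.mp hy).2
        have h1 := half_le_norm_kern (norm_gridPoint (d + 1) φ y) (n + 1) (by
          push_cast
          exact (mul_le_mul_of_nonneg_left hy' (by positivity)).trans hr)
        rw [kernWeight]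
        push_cast at h1
        have : ((n : ℝ) + 1) ^ 2 / 4 ≤ ‖kern (n + 1) (gridPoint (d + 1) φ y)‖ ^ 2 := by
          have h2 : (((n : ℝ) + 1) / 2) ^ 2 ≤ ‖kern (n + 1) (gridPoint (d + 1) φ y)‖ ^ 2 := by
            gcongr
          linarith [h2, show (((n : ℝ) + 1) / 2) ^ 2 = ((n : ℝ) + 1) ^ 2 / 4 by ring]
        gcongr

/-- With one factor in the window, a short arc has weight proportional to its length. -/
lemma concentration_short {n d : ℕ} {η : ℝ} (hη1 : η ≤ 1 / 32) (hd : 7 * (n + 1) ≤ d)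
    (hdη : ((n : ℝ) + 1) / η ≤ d) (hη : 0 < η) (φ : ℝ) :
    η * ∑ y, kernWeight n 1 d φ y ≤
      ∑ y with ‖gridPoint (d + 1) φ y - 1‖ ≤ 8 * Real.pi * η / (n + 1),
        kernWeight n 1 d φ y := by
  have hn : (0 : ℝ) < (n : ℝ) + 1 := by positivity
  have hpi := Real.pi_pos
  have hpi4 := Real.pi_lt_four
  have h1 : ∑ y, kernWeight n 1 d φ y = ((d + 1 : ℕ) : ℝ) * (n + 1) := by
    rw [← sum_norm_kern_sq n d (by omega) φ]
    simp [kernWeight]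
  rw [h1]
  -- The constant 8π makes the arc's lower bound exactly η times the Parseval total; η ≤ 1/32 and π
  -- < 4 keep the arc inside the peak.
  refine le_trans (le_of_eq ?_) (le_sum_kernWeight_near n 1 d φ _ ?_ ?_)
  · field_simp
    ring
  · rw [mul_div_cancel₀ _ hn.ne']
    nlinarith
  · rw [div_le_iff₀ hη] at hdη
    rw [← mul_div_assoc, le_div_iff₀ hn]
    push_cast
    nlinarith [mul_pos hpi hη]

/-- With many factors in the window, the weight away from phase zero is exponentially small. -/
lemma concentration_long {n k d : ℕ} {δ : ℝ} (hδ : 8 * Real.pi ≤ δ * 4 ^ k)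
    (hd : 7 * (n + 1) ≤ d) (φ : ℝ) :
    (1 - δ) * ∑ y, kernWeight n (k + 1) d φ y ≤
      ∑ y with ‖gridPoint (d + 1) φ y - 1‖ ≤ 8 / (n + 1), kernWeight n (k + 1) d φ y := by
  have hn : (0 : ℝ) < (n : ℝ) + 1 := by positivity
  have hpi := Real.pi_pos
  have hpi4 := Real.pi_lt_d2
  have hδ0 : 0 < δ := by
    by_contra hneg
    have : δ * 4 ^ k ≤ 0 := mul_nonpos_of_nonpos_of_nonneg (not_lt.mp hneg) (by positivity)
    linarith
  set Z := ∑ y, kernWeight n (k + 1) d φ y with hZ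
  have hsplit := Finset.sum_filter_add_sum_filter_not Finset.univ
    (fun y => ‖gridPoint (d + 1) φ y - 1‖ ≤ 8 / (n + 1)) (kernWeight n (k + 1) d φ)
  have hlow : ((d + 1 : ℕ) : ℝ) * (n + 1) / (8 * Real.pi) * (((n : ℝ) + 1) ^ 2 / 4) ^ k ≤ Z := by
    have h1 := le_sum_kernWeight_near n (k + 1) d φ (1 / (n + 1))
      (by rw [mul_one_div_cancel hn.ne']) (by
        rw [mul_one_div, le_div_iff₀ hn]
        have : ((7 * (n + 1) : ℕ) : ℝ) ≤ d := by exact_mod_cast hd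
        push_cast at this ⊢
        nlinarith)
    refine le_trans (le_of_eq ?_) (h1.trans
      (Finset.sum_le_sum_of_subset_of_nonneg (Finset.filter_subset _ _)
        fun y _ _ => kernWeight_nonneg _ _ _ _ _))
    rw [pow_succ]
    field_simp
    ring
  -- Of the k + 1 factors, k are bounded pointwise off the arc and the last is summed by Parseval.
  -- The bound thus has the same factor L(n + 1) as `hlow`, and only 8π/4^k remains in the
  -- comparison.
  have htail : ∑ y with ¬ ‖gridPoint (d + 1) φ y - 1‖ ≤ 8 / (n + 1),
      kernWeight n (k + 1) d φ y ≤
        (((n : ℝ) + 1) ^ 2 / 16) ^ k * (((d + 1 : ℕ) : ℝ) * (n + 1)) := by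
    rw [← sum_norm_kern_sq n d (by omega) φ, Finset.mul_sum]
    refine le_trans (Finset.sum_le_sum fun y hy => ?_)
      (Finset.sum_le_sum_of_subset_of_nonneg (Finset.filter_subset _ _)
        fun y _ _ => by positivity)
    have hy' : 8 / ((n : ℝ) + 1) < ‖gridPoint (d + 1) φ y - 1‖ :=
      not_le.mp (Finset.mem_filter.mp hy).2
    rw [kernWeight, pow_succ]
    have hk := norm_kern_mul_le (norm_gridPoint (d + 1) φ y) (n + 1)
    have : ‖kern (n + 1) (gridPoint (d + 1) φ y)‖ ≤ ((n : ℝ) + 1) / 4 := by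
      have h1 : ‖kern (n + 1) (gridPoint (d + 1) φ y)‖ * (8 / ((n : ℝ) + 1)) ≤ 2 :=
        (mul_le_mul_of_nonneg_left hy'.le (norm_nonneg _)).trans hk
      rw [← mul_div_assoc, div_le_iff₀ hn] at h1
      linarith
    gcongr
    calc ‖kern (n + 1) (gridPoint (d + 1) φ y)‖ ^ 2 ≤ (((n : ℝ) + 1) / 4) ^ 2 := by gcongr
      _ = ((n : ℝ) + 1) ^ 2 / 16 := by ring
  have hcomp : (((n : ℝ) + 1) ^ 2 / 16) ^ k * (((d + 1 : ℕ) : ℝ) * (n + 1)) ≤ δ * Z := by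
    refine le_trans ?_ (mul_le_mul_of_nonneg_left hlow hδ0.le)
    have e : (((n : ℝ) + 1) ^ 2 / 4) ^ k = 4 ^ k * (((n : ℝ) + 1) ^ 2 / 16) ^ k := by
      rw [← mul_pow]; congr 1; ring
    rw [e]
    have : δ * (((d + 1 : ℕ) : ℝ) * (n + 1) / (8 * Real.pi) *
        (4 ^ k * (((n : ℝ) + 1) ^ 2 / 16) ^ k)) =
        (δ * 4 ^ k / (8 * Real.pi)) *
          ((((n : ℝ) + 1) ^ 2 / 16) ^ k * (((d + 1 : ℕ) : ℝ) * (n + 1))) := by ring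
    rw [this]
    refine le_mul_of_one_le_left (by positivity) ?_
    rwa [le_div_iff₀ (by positivity), one_mul]
  linarith

/-! ### Correctness -/

/-- The difference factors as sin(x + t) sin(x - t), and x - t = (x + t) - 2t bounds the second
factor by 2|sin t| + s. With |sin t| = √p the error shrinks as p does. -/
lemma abs_sin_sq_sub_le {x t s : ℝ} (h : |Real.sin (x + t)| ≤ s) :
    |Real.sin x ^ 2 - Real.sin t ^ 2| ≤ s * (2 * |Real.sin t| + s) := by
  have e : Real.sin x ^ 2 - Real.sin t ^ 2 = Real.sin (x + t) * Real.sin (x - t) := by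
    rw [Real.sin_add, Real.sin_sub]
    have h1 := Real.sin_sq_add_cos_sq x
    have h2 := Real.sin_sq_add_cos_sq t
    linear_combination (-Real.sin x ^ 2) * h2 + Real.sin t ^ 2 * h1
  have e2 : Real.sin (x - t) = Real.sin (x + t) * Real.cos (2 * t) -
      Real.cos (x + t) * (2 * Real.sin t * Real.cos t) := by
    rw [← Real.sin_two_mul, ← Real.sin_sub]
    congr 1; ring
  have h3 : |Real.sin (x - t)| ≤ 2 * |Real.sin t| + s := by
    rw [e2]
    refine (abs_sub _ _).trans ?_
    have a1 : |Real.sin (x + t) * Real.cos (2 * t)| ≤ s := by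
      rw [abs_mul]
      exact (mul_le_of_le_one_right (abs_nonneg _) (Real.abs_cos_le_one _)).trans h
    have a2 : |Real.cos (x + t) * (2 * Real.sin t * Real.cos t)| ≤ 2 * |Real.sin t| := by
      rw [abs_mul, abs_mul, abs_mul, abs_two]
      refine (mul_le_of_le_one_left (by positivity) (Real.abs_cos_le_one _)).trans ?_
      exact mul_le_of_le_one_right (by positivity) (Real.abs_cos_le_one _)
    linarith
  rw [e, abs_mul]
  exact mul_le_mul h h3 (abs_nonneg _) ((abs_nonneg _).trans h)

/-- Chord length is twice the sine of the half angle; this translates closeness to the kernel's peak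
into the hypothesis of `abs_sin_sq_sub_le`. -/
lemma norm_gridPoint_sub_one (L : ℕ) (t : ℝ) (y : Fin L) :
    ‖gridPoint L (2 * t) y - 1‖ = 2 * |Real.sin (Real.pi * (y : ℕ) / L + t)| := by
  have : gridPoint L (2 * t) y =
      Complex.exp (Complex.I * ((2 * (Real.pi * (y : ℕ) / L + t) : ℝ) : ℂ)) := by
    rw [gridPoint, unityRoot, ← Complex.exp_nat_mul, ← Complex.exp_add]
    congr 1; push_cast; ring
  rw [this, Complex.norm_exp_I_mul_ofReal_sub_one, mul_div_cancel_left₀ _ two_ne_zero,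
    Real.norm_eq_abs, abs_mul, abs_two]

lemma weight_eq_card {N T : ℕ} {O : Fin T → Fin N} {D : Fin N → ℝ} (h : Represents O D)
    (S : Finset (Fin N)) :
    weight D S = ((Finset.univ.filter fun t => O t ∈ S).card : ℝ) / T := by
  rw [weight, Finset.sum_congr rfl fun i _ => h i, ← Finset.sum_div, ← Nat.cast_sum]
  congr 2
  rw [Finset.card_eq_sum_card_fiberwise (f := O) (t := S) (fun t ht => by simpa using ht)]
  refine Finset.sum_congr rfl fun i hi => congrArg Finset.card ?_
  ext t
  simp only [Finset.mem_filter, Finset.mem_univ, true_and]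
  exact ⟨fun h => ⟨h ▸ hi, h⟩, fun h => h.2⟩

section

variable {N T : ℕ} [NeZero N] [NeZero T]

lemma outputProb_nonneg (A : QueryAlgorithm N T) (O : Fin T → Fin N) (E : Set ℝ) :
    0 ≤ A.outputProb O E := by
  unfold QueryAlgorithm.outputProb
  exact Finset.sum_nonneg fun x _ => by split_ifs <;> positivity

/-- The phase merges with the Fourier node, so the amplitude at y is the window polynomial at the
grid point; Parseval identifies the normalisation with the total weight. -/
lemma norm_sq_sum_dft_window {n K d : ℕ} (h : K * n ≤ d) (φ : ℝ) (y : Fin (d + 1)) :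
    ‖∑ w, dft (d + 1) y w * window (n + 1) K d w *
      Complex.exp (φ * Complex.I) ^ (w : ℕ)‖ ^ 2 =
      kernWeight n K d φ y / ∑ y', kernWeight n K d φ y' := by
  have hm := windowMass_pos (Nat.succ_pos n) K d
  have hL : (0 : ℝ) ≤ ((d + 1 : ℕ) : ℝ) := Nat.cast_nonneg _
  have h1 : ∑ w, dft (d + 1) y w * window (n + 1) K d w *
      Complex.exp (φ * Complex.I) ^ (w : ℕ) =
      kern (n + 1) (gridPoint (d + 1) φ y) ^ K /
        ((Real.sqrt ((d + 1 : ℕ) : ℝ) : ℂ) * (Real.sqrt (windowMass (n + 1) K d) : ℂ)) := by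
    rw [← sum_windowPoly_coeff (n := n + 1) (K := K) (d := d) (by simpa using h),
      Finset.sum_div]
    refine Finset.sum_congr rfl fun w _ => ?_
    rw [dft, Matrix.of_apply, window, gridPoint, mul_pow]
    ring
  rw [h1, sum_kernWeight h, kernWeight, norm_div, norm_mul, div_pow, mul_pow, norm_pow,
    Complex.norm_real, Complex.norm_real, Real.norm_eq_abs, Real.norm_eq_abs, sq_abs, sq_abs,
    Real.sq_sqrt hL, Real.sq_sqrt hm.le, ← pow_mul, ← pow_mul, mul_comm K 2]

/-- If the kernel weight within `u` of phase zero is a fraction at least `q`, the estimate is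
accurate to `u √p + u² / 4` with probability at least `q`. -/
lemma le_outputProb {S : Finset (Fin N)} {n K d M : ℕ} {O : Fin T → Fin N} {p u ε q : ℝ}
    (hp : p = ((Finset.univ.filter fun t => O t ∈ S).card : ℝ) / T)
    (hM : K * n ≤ M / 2) (hd : K * n ≤ d) (hε : u * Real.sqrt p + u ^ 2 / 4 ≤ ε)
    (hq : ∀ φ, q * ∑ y, kernWeight n K d φ y ≤
      ∑ y with ‖gridPoint (d + 1) φ y - 1‖ ≤ u, kernWeight n K d φ y) :
    q ≤ (amplitudeEstimation S n K d M).outputProb O {x : ℝ | |x - p| ≤ ε} := by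
  classical
  have hT : (0 : ℝ) < T := Nat.cast_pos.mpr (NeZero.pos T)
  have hp0 : 0 ≤ p := by rw [hp]; positivity
  have hp1 : p ≤ 1 := by
    rw [hp, div_le_one hT]
    have := Finset.card_filter_le (Finset.univ : Finset (Fin T)) (fun t => O t ∈ S)
    rw [Finset.card_univ, Fintype.card_fin] at this
    exact_mod_cast this
  set θ := Real.arcsin (Real.sqrt p) with hθ
  have hsin : Real.sin θ = Real.sqrt p :=
    Real.sin_arcsin (by linarith [Real.sqrt_nonneg p]) (Real.sqrt_le_one.mpr hp1)
  have hsq : Real.sin θ ^ 2 = p := by rw [hsin, Real.sq_sqrt hp0]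
  have hθ0 : 0 ≤ θ := Real.arcsin_nonneg.mpr (Real.sqrt_nonneg p)
  have hθ1 : θ ≤ Real.pi / 2 := Real.arcsin_le_pi_div_two _
  rw [outputProb_eq_sum S n K M O hM]
  -- The phases ±2θ need not be told apart, since squared sine is even.
  have hacc : ∀ (t : ℝ), (t = θ ∨ t = -θ) → ∀ y : Fin (d + 1),
      ‖gridPoint (d + 1) (2 * t) y - 1‖ ≤ u →
        Real.sin (Real.pi * (y : ℕ) / (d + 1 : ℕ)) ^ 2 ∈ {x : ℝ | |x - p| ≤ ε} := by
    intro t ht y hy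
    have hst : Real.sin t ^ 2 = p ∧ |Real.sin t| = Real.sqrt p := by
      rcases ht with rfl | rfl
      · exact ⟨hsq, by rw [hsin, abs_of_nonneg (Real.sqrt_nonneg p)]⟩
      · rw [Real.sin_neg, neg_sq, abs_neg]
        exact ⟨hsq, by rw [hsin, abs_of_nonneg (Real.sqrt_nonneg p)]⟩
    rw [norm_gridPoint_sub_one] at hy
    have h1 := abs_sin_sq_sub_le (x := Real.pi * (y : ℕ) / (d + 1 : ℕ)) (t := t) (s := u / 2)
      (by linarith)
    rw [hst.1, hst.2] at h1
    exact h1.trans (by linarith)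
  have hnear : ∀ φ : ℝ, q ≤ ∑ y with ‖gridPoint (d + 1) φ y - 1‖ ≤ u,
      kernWeight n K d φ y / ∑ y', kernWeight n K d φ y' := by
    intro φ
    have hZ : 0 < ∑ y', kernWeight n K d φ y' := by
      rw [sum_kernWeight hd]
      exact mul_pos (by positivity) (windowMass_pos (Nat.succ_pos n) K d)
    rw [← Finset.sum_div, le_div_iff₀ hZ]
    exact hq φ
  have h1 := hnear (2 * θ)
  have h2 := hnear (2 * (-θ))
  have hw : ∀ φ y, 0 ≤ kernWeight n K d φ y / ∑ y', kernWeight n K d φ y' := fun φ y =>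
    div_nonneg (kernWeight_nonneg _ _ _ _ _)
      (Finset.sum_nonneg fun _ _ => kernWeight_nonneg _ _ _ _ _)
  rw [Finset.sum_filter] at h1 h2
  have key : q ≤ ∑ y : Fin (d + 1),
      ((if ‖gridPoint (d + 1) (2 * θ) y - 1‖ ≤ u then
          kernWeight n K d (2 * θ) y / ∑ y', kernWeight n K d (2 * θ) y' else 0) +
        (if ‖gridPoint (d + 1) (2 * (-θ)) y - 1‖ ≤ u then
          kernWeight n K d (2 * (-θ)) y / ∑ y', kernWeight n K d (2 * (-θ)) y' else 0)) / 2 := by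
    rw [← Finset.sum_div, Finset.sum_add_distrib]
    linarith
  refine key.trans (Finset.sum_le_sum fun y _ => ?_)
  rw [sum_norm_sq_groverAmp S O (hsq.trans hp) hθ0 hθ1
    (fun w => dft (d + 1) y w * window (n + 1) K d w),
    norm_sq_sum_dft_window hd, norm_sq_sum_dft_window hd]
  have w1 := hw (2 * θ) y
  have w2 := hw (2 * (-θ)) y
  by_cases hE : Real.sin (Real.pi * (y : ℕ) / (d + 1 : ℕ)) ^ 2 ∈ {x : ℝ | |x - p| ≤ ε}
  · rw [if_pos hE]
    gcongr
    · split_ifs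
      exacts [le_rfl, w1]
    · split_ifs
      exacts [le_rfl, w2]
  · rw [if_neg hE, if_neg (fun h => hE (hacc _ (Or.inl rfl) y h)),
      if_neg (fun h => hE (hacc _ (Or.inr rfl) y h))]
    simp

end

/-- The number of kernel factors used at `η = log (1 / δ)`. -/
def kernelPower (η : ℝ) : ℕ := if η < 1 / 32 then 1 else ⌈η⌉₊ + 6

/-- The length of one kernel factor. -/
def kernelLength (M : ℕ) (η : ℝ) : ℕ := M / 2 / kernelPower η

/-- The resolution of the phase grid. -/
def gridSize (M : ℕ) (η : ℝ) : ℕ :=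
  ⌈((kernelLength M η : ℝ) + 1) / η⌉₊ + 7 * (kernelLength M η + 1) * kernelPower η

/-- The estimator of `D(S)` with `M` queries and confidence parameter `δ`. -/
def addEstProb (N T : ℕ) [NeZero N] [NeZero T] (S : Finset (Fin N)) (M : ℕ) (δ : ℝ) :
    QueryAlgorithm N T :=
  amplitudeEstimation S (kernelLength M (Real.log (1 / δ))) (kernelPower (Real.log (1 / δ)))
    (gridSize M (Real.log (1 / δ))) M

/-- The two entries of the maximum give u√p ≤ ε/2 and u² ≤ ε/4 respectively. -/
lemma error_le {p ε u : ℝ} (hε : 0 < ε) (hu : 0 ≤ u)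
    (h : u * max (Real.sqrt p / ε) (1 / Real.sqrt ε) ≤ 1 / 2) :
    u * Real.sqrt p + u ^ 2 / 4 ≤ ε := by
  have hs := Real.sqrt_pos.mpr hε
  have h1 : u * (Real.sqrt p / ε) ≤ 1 / 2 :=
    (mul_le_mul_of_nonneg_left (le_max_left _ _) hu).trans h
  have h2 : u * (1 / Real.sqrt ε) ≤ 1 / 2 :=
    (mul_le_mul_of_nonneg_left (le_max_right _ _) hu).trans h
  rw [← mul_div_assoc, div_le_iff₀ hε] at h1
  rw [mul_one_div, div_le_iff₀ hs] at h2
  have h3 : u ^ 2 ≤ (1 / 2 * Real.sqrt ε) ^ 2 := by gcongr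
  rw [mul_pow, Real.sq_sqrt hε.le] at h3
  linarith

lemma one_sub_le_outputProb_addEstProb {N T : ℕ} [NeZero N] [NeZero T] (S : Finset (Fin N))
    (M : ℕ) {δ : ℝ} (hδ0 : 0 < δ) (hδ1 : δ < 1) {O : Fin T → Fin N} {p ε : ℝ}
    (hp : p = ((Finset.univ.filter fun t => O t ∈ S).card : ℝ) / T) (hε : 0 < ε)
    (hM : 10000 * Real.log (1 / δ) * max (Real.sqrt p / ε) (1 / Real.sqrt ε) ≤ M) :
    1 - δ ≤ (addEstProb N T S M δ).outputProb O {x : ℝ | |x - p| ≤ ε} := by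
  have hη : 0 < Real.log (1 / δ) := Real.log_pos (by rw [lt_div_iff₀ hδ0]; linarith)
  have hδη : Real.exp (-Real.log (1 / δ)) = δ := by
    rw [one_div, Real.log_inv, neg_neg, Real.exp_log hδ0]
  unfold addEstProb
  generalize Real.log (1 / δ) = η at *
  set X := max (Real.sqrt p / ε) (1 / Real.sqrt ε) with hX
  have hX0 : 0 < X := lt_of_lt_of_le (by positivity) (le_max_right _ _)
  have hK : 0 < kernelPower η := by unfold kernelPower; split_ifs <;> omega
  set n := kernelLength M η with hn
  have hn0 : (0 : ℝ) < (n : ℝ) + 1 := by positivity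
  have hKn : kernelPower η * n ≤ M / 2 := Nat.mul_div_le _ _
  -- Rounding down twice costs only the passage from n to n + 1, so this holds even when M is too
  -- small for a single iteration and n = 0.
  have hMn : (M : ℝ) ≤ 2 * kernelPower η * (n + 1) := by
    have h1 : M / 2 < kernelPower η * (n + 1) := Nat.lt_mul_div_succ _ hK
    have h2 : M ≤ 2 * (kernelPower η * (n + 1)) := by omega
    have h3 : (M : ℝ) ≤ ((2 * (kernelPower η * (n + 1)) : ℕ) : ℝ) := by exact_mod_cast h2
    push_cast at h3
    linarith
  have hd7 : 7 * (n + 1) * kernelPower η ≤ gridSize M η := Nat.le_add_left _ _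
  have hd7' : 7 * (n + 1) ≤ gridSize M η := (Nat.le_mul_of_pos_right _ hK).trans hd7
  have hKd : kernelPower η * n ≤ gridSize M η := by
    refine le_trans ?_ hd7
    rw [mul_comm]
    exact Nat.mul_le_mul_right _ (by omega)
  have hdη : ((n : ℝ) + 1) / η ≤ gridSize M η := by
    refine (Nat.le_ceil _).trans ?_
    exact Nat.cast_le.mpr (Nat.le_add_right _ _)
  by_cases hs : η < 1 / 32
  · have hK1 : kernelPower η = 1 := if_pos hs
    rw [hK1] at hKn hMn hKd ⊢
    have hu : 0 ≤ 8 * Real.pi * η / ((n : ℝ) + 1) := by positivity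
    refine le_outputProb hp hKn hKd (error_le hε hu ?_) fun φ => ?_
    · rw [← hX, div_mul_eq_mul_div, div_le_iff₀ hn0]
      have hpi := Real.pi_lt_four
      have : 0 < η * X := mul_pos hη hX0
      push_cast at hMn
      nlinarith
    · refine le_trans ?_ (concentration_short hs.le hd7' hdη hη φ)
      refine mul_le_mul_of_nonneg_right ?_
        (Finset.sum_nonneg fun _ _ => kernWeight_nonneg _ _ _ _ _)
      rw [← hδη]
      linarith [Real.add_one_le_exp (-η)]
  · have hKe : kernelPower η = ⌈η⌉₊ + 5 + 1 := if_neg hs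
    have hs' : 1 / 32 ≤ η := not_lt.mp hs
    have hc : (⌈η⌉₊ : ℝ) < η + 1 := Nat.ceil_lt_add_one hη.le
    have hc' : η ≤ (⌈η⌉₊ : ℝ) := Nat.le_ceil η
    rw [hKe] at hKn hMn hKd ⊢
    have hu : 0 ≤ 8 / ((n : ℝ) + 1) := by positivity
    refine le_outputProb hp hKn hKd (error_le hε hu ?_) fun φ => concentration_long ?_ hd7' φ
    · rw [← hX, div_mul_eq_mul_div, div_le_iff₀ hn0]
      push_cast at hMn
      -- The number of factors is below η + 7, and 7 ≤ 224η because η ≥ 1/32.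
      have h1 : (M : ℝ) ≤ 2 * (225 * η) * (n + 1) := by
        refine hMn.trans ?_
        gcongr
        linarith
      have h2 : η * (10000 * X) ≤ η * (450 * (n + 1)) := by linarith
      have h3 := le_of_mul_le_mul_left h2 hη
      linarith
    · have hpi := Real.pi_lt_four
      -- Since e < 4, the first ⌈η⌉ factors outweigh 1/δ and five more outweigh 8π, as e⁵ ≥ 32; the
      -- sixth extra factor is the one spent on Parseval.
      have e1 : Real.exp (η + 5) ≤ 4 ^ (⌈η⌉₊ + 5) := by
        calc Real.exp (η + 5) ≤ Real.exp ((⌈η⌉₊ + 5 : ℕ) : ℝ) := by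
              gcongr; push_cast; linarith
          _ = Real.exp 1 ^ (⌈η⌉₊ + 5) := by rw [← Real.exp_nat_mul, mul_one]
          _ ≤ 4 ^ (⌈η⌉₊ + 5) := by
              gcongr; linarith [Real.exp_one_lt_d9]
      have e2 : (32 : ℝ) ≤ Real.exp 5 := by
        have : Real.exp 5 = Real.exp 1 ^ 5 := by rw [← Real.exp_nat_mul]; norm_num
        rw [this]
        calc (32 : ℝ) = 2 ^ 5 := by norm_num
          _ ≤ Real.exp 1 ^ 5 := by gcongr; linarith [Real.exp_one_gt_d9]
      calc 8 * Real.pi ≤ 32 := by linarith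
        _ ≤ Real.exp 5 := e2
        _ = δ * Real.exp (η + 5) := by rw [← hδη, ← Real.exp_add]; congr 1; ring
        _ ≤ δ * 4 ^ (⌈η⌉₊ + 5) := by gcongr

end QSamp
end

theorem mainTheorem7 :
    ∃ c : ℝ, 0 < c ∧
      ∃ AddEstProb : ∀ (N T : ℕ) [NeZero N] [NeZero T],
          Finset (Fin N) → ℕ → ℝ → QSamp.QueryAlgorithm N T,
        ∀ (N T : ℕ) [NeZero N] [NeZero T] (S : Finset (Fin N)) (M : ℕ) (δ : ℝ),
          0 < δ → δ ≤ 1 →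
          (AddEstProb N T S M δ).queries = M ∧
          ∀ (D : Fin N → ℝ), D ∈ stdSimplex ℝ (Fin N) →
            ∀ (O : Fin T → Fin N), QSamp.Represents O D →
              ∀ ε : ℝ, 0 < ε →
                c * Real.log (1 / δ) *
                    max (Real.sqrt (QSamp.weight D S) / ε) (1 / Real.sqrt ε) ≤ (M : ℝ) →
                1 - δ ≤ (AddEstProb N T S M δ).outputProb O
                  {x : ℝ | |x - QSamp.weight D S| ≤ ε} := by
  refine ⟨10000, by norm_num, @QSamp.addEstProb, fun N T _ _ S M δ hδ0 hδ1 =>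
    ⟨rfl, fun D _ O hO ε hε hM => ?_⟩⟩
  rcases hδ1.lt_or_eq with hlt | rfl
  · exact QSamp.one_sub_le_outputProb_addEstProb S M hδ0 hlt (QSamp.weight_eq_card hO S) hε hM
  -- At δ = 1 the logarithm is 0 and the circuit's grid size contains a division by 0, but only
  -- nonnegativity of a probability is claimed.
  · rw [sub_self]
    exact QSamp.outputProb_nonneg _ _ _
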